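/- **Setting.** Let $D,R\ge 0$ and $p_1,\dots,p_D$ be integers, $s=\prod_{d=1}^D p_d$, and let $\mathcal F=\{f\in C([0,1]):\int_0^1 f(x)\,dx=0\}$. For $\nu\in\mathbb R$, $\boldsymbol\beta_{r,d}\in\mathbb R^{p_d}$ and $f_r\in\mathcal F$ ($1\le r\le R$, $1\le d\le D$), the triple $(\nu,(\boldsymbol\beta_{r,d}),(f_r))$ is an *$R$-term broadcasted representation* of $m:[0,1]^{p_1\times\cdots\times p_D}\to\mathbb R$ if $$m(\mathbf X)=\nu+\frac1s\sum_{r=1}^R\big\langle \boldsymbol\beta_{r,1}\circ\cdots\circ\boldsymbol\beta_{r,D},\,F_r(\mathbf X)\big\rangle\quad\text{for all }\mathbf X,\qquad (F_r(\mathbf X))_{i_1\cdots i_D}=f_r(X_{i_1\cdots i_D}),$$ where $\circ$ is the outer product and $\langle\cdot,\cdot\rangle$ the entrywise inner product. It is *minimal* if $m$ has no $\bar R$-term representation with $\bar R<R$, and no $R$-term representation with functions $\tilde f_1,\dots,\tilde f_R\in\mathcal F$ such that $\mathrm{Span}\{\tilde f_r\}\subsetneq\mathrm{Span}\{f_r\}$.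 It is *unique up to permutation and scaling* if for every $R$-term representation $(\bar\nu,(\bar{\boldsymbol\beta}_{r,d}),(\bar f_r))$ of $m$ one has $\bar\nu=\nu$ and there are a permutation $\sigma$ of $\{1,\dots,R\}$ and scalars $c_{r,d},e_r$ with $e_r\prod_{d}c_{r,d}=1$, $\bar{\boldsymbol\beta}_{r,d}=c_{r,d}\boldsymbol\beta_{\sigma(r),d}$ and $\bar f_r=e_rf_{\sigma(r)}$ for all $r,d$. Let $\mathbf B_d=(\boldsymbol\beta_{1,d},\dots,\boldsymbol\beta_{R,d})$, and let $k_{B_d}$ be its k-rank, i.e. the largest $k\le R$ such that any $k$ columns of $\mathbf B_d$ are linearly independent. **Theorem (Identifiability).** 1. If a representation of $m$ is minimal and $\sum_{d=1}^D k_{B_d}\ge 2R+D-1$, then it is unique up to permutation and scaling. 2. If a representation of $m$ is minimal, $f_1,\dots,f_R$ are linearly independent, and $\sum_{d=1}^D k_{B_d}\ge R+D$, then it is unique up to permutation and scaling. 3. Let $D=2$, $p_1,p_2\ge1$ and $R(R-1)\le p_1(p_1-1)p_2(p_2-1)/2$. Then for Lebesgue-almost every choice of the coefficients $(\boldsymbol\beta_{r,d})_{r,d}$,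 for every $\nu\in\mathbb R$ and all linearly independent $f_1,\dots,f_R\in\mathcal F$, the representation $(\nu,(\boldsymbol\beta_{r,d}),(f_r))$ of the function $m$ it defines is unique up to permutation and scaling. 4. Let $D=3$, $p_1,p_2,p_3\ge1$ and $R(R-1)\le p_1p_2p_3(3p_1p_2p_3-p_1p_2-p_1p_3-p_2p_3-p_1-p_2-p_3+3)/4$. Then the conclusion of part 3 holds. -/

import Mathlib

open MeasureTheory

/-- Covariate tensors of size `p 0 × ⋯ × p (D-1)` with entries in `[0,1]`. -/
abbrev Covariate {D : ℕ} (p : Fin D → ℕ) : Type := (∀ d, Fin (p d)) → unitInterval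

/-- A coefficient family `β`: for every component `r` and mode `d`, a vector of `ℝ^(p d)`. -/
abbrev Coeffs {D : ℕ} (p : Fin D → ℕ) (R : ℕ) : Type := Fin R → ∀ d, Fin (p d) → ℝ

/-- The outer product `b_1 ∘ ⋯ ∘ b_D`. -/
def outerProduct {D : ℕ} {p : Fin D → ℕ} (b : ∀ d, Fin (p d) → ℝ) :
    (∀ d, Fin (p d)) → ℝ :=
  fun i => ∏ d, b d (i d)

/-- The broadcasting operator: `f` applied to every entry of `X`. -/
def broadcast {D : ℕ} {p : Fin D → ℕ} (f : C(unitInterval, ℝ)) (X : Covariate p) :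
    (∀ d, Fin (p d)) → ℝ :=
  fun i => f (X i)

/-- The entrywise inner product of two tensors. -/
def tensorInner {D : ℕ} {p : Fin D → ℕ} (A B : (∀ d, Fin (p d)) → ℝ) : ℝ :=
  ∑ i, A i * B i

/-- The function `X ↦ ν + (1/s) ∑_r ⟨β_{r,1} ∘ ⋯ ∘ β_{r,D}, F_r(X)⟩`, where `s = ∏ p_d` and
`F_r(X)` is the broadcast of `f_r`. -/
noncomputable def broadcastedModel {D : ℕ} {p : Fin D → ℕ} {R : ℕ}
    (ν : ℝ) (β : Coeffs p R) (f : Fin R → C(unitInterval, ℝ)) (X : Covariate p) : ℝ :=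
  ν + 1 / (∏ d, (p d : ℝ)) * ∑ r, tensorInner (outerProduct (β r)) (broadcast (f r) X)

/-- The class of continuous functions on `[0,1]` with integral zero. -/
def meanZeroFunctions : Set C(unitInterval, ℝ) :=
  {f | ∫ x : unitInterval, f x = 0}

/-- `(ν, β, f)` is a broadcasted representation of `m` with `R` components and with
mean-zero continuous functions. -/
def IsRepresentation {D : ℕ} {p : Fin D → ℕ} {R : ℕ} (m : Covariate p → ℝ)
    (ν : ℝ) (β : Coeffs p R) (f : Fin R → C(unitInterval, ℝ)) : Prop :=
  (∀ r, f r ∈ meanZeroFunctions) ∧ ∀ X, m X = broadcastedModel ν β f X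

/-- A minimal representation: no representation of `m` has fewer components, and none with
the same number of components has functions spanning a strictly smaller space. -/
def IsMinimalRepresentation {D : ℕ} {p : Fin D → ℕ} {R : ℕ} (m : Covariate p → ℝ)
    (ν : ℝ) (β : Coeffs p R) (f : Fin R → C(unitInterval, ℝ)) : Prop :=
  IsRepresentation m ν β f ∧
  (∀ R' < R, ¬ ∃ (ν' : ℝ) (β' : Coeffs p R') (f' : Fin R' → C(unitInterval, ℝ)),
    IsRepresentation m ν' β' f') ∧
  ¬ ∃ (ν' : ℝ) (β' : Coeffs p R) (f' : Fin R → C(unitInterval, ℝ)),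
    IsRepresentation m ν' β' f' ∧
      Submodule.span ℝ (Set.range f') < Submodule.span ℝ (Set.range f)

/-- The components `(β_{r,1}, …, β_{r,D}, f_r)` and `(β'_{r,1}, …, β'_{r,D}, f'_r)` agree up to
a permutation of the components and, within each component, a rescaling of the
`D + 1` factors by numbers whose product is `1`. -/
def SameUpToPermScaling {D : ℕ} {p : Fin D → ℕ} {R : ℕ}
    (β : Coeffs p R) (f : Fin R → C(unitInterval, ℝ))
    (β' : Coeffs p R) (f' : Fin R → C(unitInterval, ℝ)) : Prop :=
  ∃ (σ : Equiv.Perm (Fin R)) (c : Fin R → Fin D → ℝ) (e : Fin R → ℝ),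
    ∀ r, (∏ d, c r d) * e r = 1 ∧
      (∀ d, β' r d = c r d • β (σ r) d) ∧ f' r = e r • f (σ r)

/-- The representation `(ν, β, f)` of `m` is unique up to permutation and scaling among all
representations of `m` with the same number of components. -/
def IsUniqueRepresentation {D : ℕ} {p : Fin D → ℕ} {R : ℕ} (m : Covariate p → ℝ)
    (ν : ℝ) (β : Coeffs p R) (f : Fin R → C(unitInterval, ℝ)) : Prop :=
  IsRepresentation m ν β f ∧
  ∀ (ν' : ℝ) (β' : Coeffs p R) (f' : Fin R → C(unitInterval, ℝ)),
    IsRepresentation m ν' β' f' → ν = ν' ∧ SameUpToPermScaling β f β' f'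

/-- The factor matrix `B_d`, whose columns are `β_{1,d}, …, β_{R,d}`. -/
def factorMatrix {D : ℕ} {p : Fin D → ℕ} {R : ℕ} (β : Coeffs p R) (d : Fin D) :
    Matrix (Fin (p d)) (Fin R) ℝ :=
  Matrix.of fun i r => β r d i

/-- Kruskal's k-rank: the largest `k`, at most the number of columns, such that any `k` columns
are linearly independent. -/
noncomputable def kRank {n R : ℕ} (B : Matrix (Fin n) (Fin R) ℝ) : ℕ :=
  sSup {k | k ≤ R ∧ ∀ S : Finset (Fin R), S.card = k →
    LinearIndependent ℝ (fun r : S => B.col r)}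

/-!
A broadcasted model determines its intercept and, for every index `i` of the covariate tensor, the
function `∑ r, (β_{r,1} ∘ ⋯ ∘ β_{r,D})_i • f_r` (vary one entry of `X` at a time and use that the
functions have mean zero: `IsRepresentation.eq_and_sum_eq`). A representation is therefore a
decomposition of a tensor with `D + 1` modes into rank-one terms, the last mode being indexed by
`[0,1]`, and the factors of a nonzero rank-one term are unique up to scaling
(`exists_smul_of_prodTensor_eq`). It remains to show that the rank-one terms are unique.

*Conditions on k-ranks.* This is Kruskal's theorem for any number of modes
(`exists_perm_of_kruskal`). The difference of two decompositions is a vanishing sum of rank-one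
tensors `∏ j, y a j`, which falls into minimal vanishing sums. Consider one of these, with index set
`ι`, and let `A j` be the row space in `ι → ℝ` of the factors of mode `j`. The pointwise product of
the `A j` is annihilated by a linear form, and minimality says that it is stable under the
restriction to no proper part of `ι`. For such products Kneser's inequality
`dim A + dim B ≤ dim (A * B) + 1` holds (`finrank_add_finrank_le_finrank_mul`); the proof iterates
the transform `(A, B) ↦ (A ∩ g⁻¹B, B + gA)`. So a minimal vanishing sum with large factor ranks has
many terms (`sum_finrank_rowSpace_add_two_le`). The bound on the k-ranks makes this impossible unless
every minimal vanishing sum consists of one term from each decomposition. Minimality of the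
representation enters only to exclude vanishing terms.

*Generic coefficients.* Almost all coefficient families are algebraically independent over `ℚ`
(`ae_algebraicIndependent_coeffs`). If the functions are linearly independent, both decompositions
have the same span of coefficient tensors, so it suffices that the span of the `x_r = prodTensor (β r)`
contains no rank-one tensors besides their multiples. Suppose that `∑ c_r x_r = y` has rank at most
one, with two or more nonzero `c_r`. A derivation of `ℝ` may take any values on algebraically
independent numbers (`AlgebraicIndependent.exists_derivation`), and differentiating the equation
shows that the tangent spaces at the `x_r` lie in the sum of the span of the `x_r` and the tangent
space at `y`. This bounds the dimension of their sum from above. A minor that is nonzero when the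
`x_r` are standard basis tensors bounds it from below by the number of points in a union of Hamming
balls (`card_hammingNhds_le_finrank`). The bounds contradict each other as long as the number of
terms is at most the codimension of the variety of rank-one tensors (`sum_smul_prodTensor_ne`).
The numerical conditions for two and three modes imply this, except for matrices with two rows or
two columns (up to modes of size one), to which Kruskal's condition applies.
-/

/-! ### Kneser's inequality for pointwise products of function spaces -/

/-- A space `P` of functions on `ι` splits if the restriction to some nonempty proper subset of
`ι`, extended by zero, maps `P` into itself. -/
def Splits {ι : Type*} (P : Submodule ℝ (ι → ℝ)) : Prop :=
  ∃ S : Set ι, S.Nonempty ∧ Sᶜ.Nonempty ∧ ∀ p ∈ P, S.indicator p ∈ P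

lemma exists_mem_forall_notMem {E I : Type*} [AddCommGroup E] [Module ℝ E] [Finite I]
    (B : Submodule ℝ E) (W : I → Submodule ℝ E) (h : ∀ i, ¬ B ≤ W i) :
    ∃ b ∈ B, ∀ i, b ∉ W i := by
  by_contra! hc
  have hcov : ⋃ i, (((W i).comap B.subtype : Submodule ℝ B) : Set B) = Set.univ := by
    ext b
    obtain ⟨i, hi⟩ := hc b b.2
    simpa using ⟨i, hi⟩
  obtain ⟨i, hi⟩ := Subspace.exists_eq_top_of_iUnion_eq_univ hcov
  exact h i fun b hb => by
    have : (⟨b, hb⟩ : B) ∈ (W i).comap B.subtype := hi ▸ Submodule.mem_top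
    simpa using this

lemma exists_mem_forall_ne_zero {ι : Type*} [Finite ι] (A : Submodule ℝ (ι → ℝ))
    (hA : ∀ a, ∃ f ∈ A, f a ≠ 0) : ∃ f ∈ A, ∀ a, f a ≠ 0 := by
  obtain ⟨f, hf, h⟩ := exists_mem_forall_notMem A
    (fun a : ι => LinearMap.ker (LinearMap.proj a : (ι → ℝ) →ₗ[ℝ] ℝ)) fun a hle => by
      obtain ⟨f, hf, hfa⟩ := hA a
      exact hfa (by simpa using hle hf)
  exact ⟨f, hf, fun a => by simpa using h a⟩

/-- The nowhere vanishing elements of `B` span `B` as soon as there is one. -/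
lemma mul_mem_of_forall_ne_zero {ι : Type*} [Finite ι] {A B : Submodule ℝ (ι → ℝ)}
    {b : ι → ℝ} (hb : b ∈ B) (hb0 : ∀ a, b a ≠ 0)
    (h : ∀ g ∈ B, (∀ a, g a ≠ 0) → ∀ f ∈ A, g * f ∈ B) :
    ∀ g ∈ B, ∀ f ∈ A, g * f ∈ B := by
  intro g hg f hf
  obtain ⟨t, ht⟩ := (Set.finite_range fun a => - g a / b a).exists_notMem
  have h1 : ∀ a, (g + t • b) a ≠ 0 := by
    intro a h0
    refine ht ⟨a, ?_⟩
    have := hb0 a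
    simp only [Pi.add_apply, Pi.smul_apply, smul_eq_mul] at h0
    field_simp
    linarith
  have h2 := h _ (B.add_mem hg (B.smul_mem t hb)) h1 f hf
  have h3 := B.smul_mem t (h b hb hb0 f hf)
  have : g * f = (g + t • b) * f - t • (b * f) := by
    rw [add_mul, smul_mul_assoc]; abel
  rw [this]
  exact B.sub_mem h2 h3

lemma finrank_map_mulLeft {ι : Type*} [Finite ι] (A : Submodule ℝ (ι → ℝ)) {g : ι → ℝ}
    (hg : ∀ a, g a ≠ 0) :
    Module.finrank ℝ (A.map (LinearMap.mulLeft ℝ g)) = Module.finrank ℝ A := by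
  refine (Submodule.equivMapOfInjective _ ?_ A).finrank_eq.symm
  intro x y hxy
  ext a
  have := congrFun hxy a
  simpa [hg a] using this

/-- One step of the `e`-transform: `A ∩ g⁻¹B` and `B + gA` have the same total dimension as `A`
and `B`. -/
lemma finrank_eTransform {ι : Type*} [Finite ι] (A B : Submodule ℝ (ι → ℝ)) {g : ι → ℝ}
    (hg : ∀ a, g a ≠ 0) :
    Module.finrank ℝ (A ⊓ B.comap (LinearMap.mulLeft ℝ g) : Submodule ℝ (ι → ℝ)) +
      Module.finrank ℝ (B ⊔ A.map (LinearMap.mulLeft ℝ g) : Submodule ℝ (ι → ℝ)) =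
      Module.finrank ℝ A + Module.finrank ℝ B := by
  have h1 := Submodule.finrank_sup_add_finrank_inf_eq B (A.map (LinearMap.mulLeft ℝ g))
  rw [finrank_map_mulLeft A hg, inf_comm, Submodule.map_inf_eq_map_inf_comap,
    finrank_map_mulLeft _ hg] at h1
  omega

lemma mul_eTransform_le {ι : Type*} (A B : Submodule ℝ (ι → ℝ)) (g : ι → ℝ) :
    (A ⊓ B.comap (LinearMap.mulLeft ℝ g)) * (B ⊔ A.map (LinearMap.mulLeft ℝ g)) ≤ A * B := by
  rw [Submodule.mul_sup, sup_le_iff]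
  refine ⟨Submodule.mul_le.2 fun m hm n hn => Submodule.mul_mem_mul hm.1 hn, ?_⟩
  refine Submodule.mul_le.2 fun m hm n hn => ?_
  obtain ⟨a, ha, rfl⟩ := hn
  have : m * (LinearMap.mulLeft ℝ g) a = a * (g * m) := by
    simp only [LinearMap.mulLeft_apply]; ring
  rw [this]
  exact Submodule.mul_mem_mul ha hm.2

/-- Iterating the `e`-transform ends with a pair `(U, V)` for which `U` acts on `V`. -/
lemma exists_stable_eTransform {ι : Type*} [Finite ι] (n : ℕ) :
    ∀ A B : Submodule ℝ (ι → ℝ), Module.finrank ℝ A = n → 1 ∈ A → (∃ b ∈ B, ∀ a, b a ≠ 0) →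
    ∃ U V : Submodule ℝ (ι → ℝ), 1 ∈ U ∧ B ≤ V ∧ U * V ≤ A * B ∧ U * V ≤ V ∧
      Module.finrank ℝ U + Module.finrank ℝ V = Module.finrank ℝ A + Module.finrank ℝ B := by
  induction n using Nat.strong_induction_on with
  | _ n ih =>
    intro A B hn h1 hB
    obtain ⟨b, hb, hb0⟩ := hB
    by_cases h : ∀ g ∈ B, (∀ a, g a ≠ 0) → ∀ f ∈ A, g * f ∈ B
    · refine ⟨A, B, h1, le_rfl, le_rfl, ?_, rfl⟩
      refine Submodule.mul_le.2 fun f hf g hg => ?_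
      rw [mul_comm]
      exact mul_mem_of_forall_ne_zero hb hb0 h g hg f hf
    · push Not at h
      obtain ⟨g, hg, hg0, f, hf, hfg⟩ := h
      have hlt : A ⊓ B.comap (LinearMap.mulLeft ℝ g) < A := by
        refine lt_of_le_of_ne inf_le_left fun he => hfg ?_
        rw [← he] at hf
        exact hf.2
      have hfin := Submodule.finrank_lt_finrank_of_lt hlt
      obtain ⟨U, V, hU, hV, hP, hs, hd⟩ := ih _ (hn ▸ hfin)
        (A ⊓ B.comap (LinearMap.mulLeft ℝ g)) (B ⊔ A.map (LinearMap.mulLeft ℝ g)) rfl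
        ⟨h1, by simpa using hg⟩ ⟨b, Submodule.mem_sup_left hb, hb0⟩
      exact ⟨U, V, hU, le_sup_left.trans hV, hP.trans (mul_eTransform_le A B g), hs,
        hd.trans (finrank_eTransform A B hg0)⟩

/-- If a non-constant function acts on `V`, then so does the indicator of one of its level sets,
which is a polynomial in that function. -/
lemma splits_of_mul_mem {ι : Type*} [Finite ι] {V : Submodule ℝ (ι → ℝ)} {u : ι → ℝ}
    (hu : ∀ v ∈ V, u * v ∈ V) {a₀ a₁ : ι} (hne : u a₀ ≠ u a₁) : Splits V := by
  classical
  have := Fintype.ofFinite ι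
  refine ⟨{a | u a = u a₀}, ⟨a₀, rfl⟩, ⟨a₁, fun h => hne h.symm⟩, fun v hv => ?_⟩
  have key : ∀ F : Finset ℝ, (fun a => (∏ c ∈ F, (u a - c)) * v a) ∈ V := by
    intro F
    induction F using Finset.induction_on with
    | empty => simpa using hv
    | insert c F hc ih =>
      have h := V.sub_mem (hu _ ih) (V.smul_mem c ih)
      convert h using 1
      ext a
      simp only [Finset.prod_insert hc, Pi.sub_apply, Pi.mul_apply, Pi.smul_apply, smul_eq_mul]
      ring
  set F : Finset ℝ := (Finset.univ.image u).erase (u a₀) with hF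
  have h := V.smul_mem (∏ c ∈ F, (u a₀ - c))⁻¹ (key F)
  convert h using 1
  ext a
  simp only [Set.indicator, Set.mem_ofPred_eq, Pi.smul_apply, smul_eq_mul]
  split_ifs with ha
  · rw [ha, inv_mul_cancel_left₀]
    refine Finset.prod_ne_zero_iff.2 fun c hc => sub_ne_zero.2 ?_
    exact (Finset.ne_of_mem_erase hc).symm
  · rw [Finset.prod_eq_zero (i := u a) (by simp [hF, ha]) (sub_self _)]
    simp

lemma exists_ne_of_one_lt_finrank {ι : Type*} [Finite ι] {U : Submodule ℝ (ι → ℝ)}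
    (hU : 1 < Module.finrank ℝ U) : ∃ u ∈ U, ∃ a b, u a ≠ u b := by
  by_contra! h
  have hle : U ≤ Submodule.span ℝ {(1 : ι → ℝ)} := by
    intro u hu
    rcases isEmpty_or_nonempty ι with hι | ⟨⟨a⟩⟩
    · rw [Subsingleton.elim u 0]; exact zero_mem _
    · refine Submodule.mem_span_singleton.2 ⟨u a, ?_⟩
      ext b
      simp [h u hu a b]
  have h1 := Submodule.finrank_mono hle
  have h2 : Module.finrank ℝ (Submodule.span ℝ {(1 : ι → ℝ)}) ≤ 1 := by
    simpa using finrank_span_le_card (R := ℝ) {(1 : ι → ℝ)}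
  omega

lemma indicator_mul_comm {ι : Type*} (S : Set ι) (f g : ι → ℝ) :
    S.indicator (f * g) = f * S.indicator g := by
  ext a
  by_cases h : a ∈ S <;> simp [h]

/-- Kneser's inequality in contrapositive form, for `A` containing the constants. -/
lemma splits_of_finrank_mul_lt_of_one_mem {ι : Type*} [Finite ι] (A B : Submodule ℝ (ι → ℝ))
    (h1 : 1 ∈ A) (hB : ∀ a, ∃ f ∈ B, f a ≠ 0)
    (hlt : Module.finrank ℝ (A * B : Submodule ℝ (ι → ℝ)) + 1 <
      Module.finrank ℝ A + Module.finrank ℝ B) : Splits (A * B) := by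
  -- For every nowhere vanishing `b ∈ B`, some indicator multiplies `bA` into `A * B`.
  have key : ∀ b ∈ B, (∀ a, b a ≠ 0) → ∃ S : Set ι, S.Nonempty ∧ Sᶜ.Nonempty ∧
      ∀ f ∈ A, S.indicator (f * b) ∈ A * B := by
    intro b hb hb0
    obtain ⟨U, V, hU, hV, hP, hs, hd⟩ := exists_stable_eTransform _
      (A ⊓ B.comap (LinearMap.mulLeft ℝ b)) (B ⊔ A.map (LinearMap.mulLeft ℝ b)) rfl
      ⟨h1, by simpa using hb⟩ ⟨b, Submodule.mem_sup_left hb, hb0⟩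
    rw [finrank_eTransform A B hb0] at hd
    have hVP : V ≤ A * B := fun v hv =>
      mul_eTransform_le A B b (hP (by simpa using Submodule.mul_mem_mul hU hv))
    have hfin := Submodule.finrank_mono hVP
    obtain ⟨u, hu, a₀, a₁, hne⟩ := exists_ne_of_one_lt_finrank (U := U) (by omega)
    obtain ⟨S, hS, hS', hSV⟩ := splits_of_mul_mem (V := V)
      (fun v hv => hs (Submodule.mul_mem_mul hu hv)) hne
    refine ⟨S, hS, hS', fun f hf => hVP (hSV _ (hV (Submodule.mem_sup_right ?_)))⟩
    exact ⟨f, hf, by simp [mul_comm]⟩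
  -- One indicator works for all `b`, as `B` is not a finite union of proper subspaces.
  by_contra hns
  let W : Set ι → Submodule ℝ (ι → ℝ) := fun S =>
    { carrier := {b | ∀ f ∈ A, S.indicator (f * b) ∈ A * B}
      zero_mem' := fun f _ => by simp
      add_mem' := fun {x y} hx hy f hf => by
        rw [mul_add, Set.indicator_add']
        exact Submodule.add_mem _ (hx f hf) (hy f hf)
      smul_mem' := fun c x hx f hf => by
        rw [mul_smul_comm, show S.indicator (c • (f * x)) = c • S.indicator (f * x) from
          Set.indicator_const_smul S c (f * x)]
        exact Submodule.smul_mem _ c (hx f hf) }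
  obtain ⟨b, hb, hbW⟩ := exists_mem_forall_notMem B
    (Sum.elim (fun a : ι => LinearMap.ker (LinearMap.proj a : (ι → ℝ) →ₗ[ℝ] ℝ))
      (fun S : {S : Set ι // S.Nonempty ∧ Sᶜ.Nonempty} => W S)) (by
    rintro (a | ⟨S, hS, hS'⟩) hle
    · obtain ⟨f, hf, hfa⟩ := hB a
      exact hfa (by simpa using hle hf)
    · refine hns ⟨S, hS, hS', fun p hp => ?_⟩
      induction hp using Submodule.mul_induction_on' with
      | mem_mul_mem f hf g hg => exact hle hg f hf
      | add x _ y _ hx hy => rw [Set.indicator_add']; exact Submodule.add_mem _ hx hy)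
  obtain ⟨S, hS, hS', h⟩ := key b hb fun a => by simpa using hbW (Sum.inl a)
  exact hbW (Sum.inr ⟨S, hS, hS'⟩) h

/-- Kneser's inequality for pointwise products of function spaces, in the case where the product
space is stable under no nontrivial indicator. -/
theorem finrank_add_finrank_le_finrank_mul {ι : Type*} [Finite ι] (A B : Submodule ℝ (ι → ℝ))
    (hA : ∀ a, ∃ f ∈ A, f a ≠ 0) (hB : ∀ a, ∃ f ∈ B, f a ≠ 0) (hs : ¬ Splits (A * B)) :
    Module.finrank ℝ A + Module.finrank ℝ B ≤
      Module.finrank ℝ (A * B : Submodule ℝ (ι → ℝ)) + 1 := by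
  by_contra! hlt
  obtain ⟨f, hf, hf0⟩ := exists_mem_forall_ne_zero A hA
  have hf0' : ∀ a, f⁻¹ a ≠ 0 := fun a => inv_ne_zero (hf0 a)
  have hff : f * f⁻¹ = 1 := by ext a; simp [hf0 a]
  have hmul : A.map (LinearMap.mulLeft ℝ f⁻¹) * B = (A * B).map (LinearMap.mulLeft ℝ f⁻¹) := by
    refine le_antisymm (Submodule.mul_le.2 ?_) ?_
    · rintro _ ⟨g, hg, rfl⟩ h hh
      exact ⟨g * h, Submodule.mul_mem_mul hg hh, by simp [mul_assoc]⟩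
    · rw [Submodule.map_le_iff_le_comap, Submodule.mul_le]
      intro g hg h hh
      rw [Submodule.mem_comap, LinearMap.mulLeft_apply, ← mul_assoc]
      exact Submodule.mul_mem_mul ⟨g, hg, rfl⟩ hh
  obtain ⟨S, hS, hS', h⟩ := splits_of_finrank_mul_lt_of_one_mem
    (A.map (LinearMap.mulLeft ℝ f⁻¹)) B ⟨f, hf, by rw [LinearMap.mulLeft_apply, mul_comm, hff]⟩ hB
    (by rw [hmul, finrank_map_mulLeft _ hf0', finrank_map_mulLeft _ hf0']; exact hlt)
  refine hs ⟨S, hS, hS', fun p hp => ?_⟩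
  obtain ⟨q, hq, hqp⟩ := hmul ▸ h (f⁻¹ * p) (hmul ▸ ⟨p, hp, rfl⟩)
  rw [LinearMap.mulLeft_apply, indicator_mul_comm] at hqp
  have : q = S.indicator p := by
    rw [← one_mul q, ← hff, mul_assoc, hqp, ← mul_assoc, hff, one_mul]
  exact this ▸ hq

lemma Splits.mul_left {ι : Type*} {P : Submodule ℝ (ι → ℝ)} (hP : Splits P)
    (A : Submodule ℝ (ι → ℝ)) : Splits (A * P) := by
  obtain ⟨S, hS, hS', h⟩ := hP
  refine ⟨S, hS, hS', fun p hp => ?_⟩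
  induction hp using Submodule.mul_induction_on' with
  | mem_mul_mem f hf g hg => rw [indicator_mul_comm]; exact Submodule.mul_mem_mul hf (h g hg)
  | add x _ y _ hx hy => rw [Set.indicator_add']; exact Submodule.add_mem _ hx hy

/-- Kneser's inequality for several factors. -/
theorem sum_finrank_le_finrank_prod {ι J : Type*} [Finite ι] [Nonempty ι]
    (A : J → Submodule ℝ (ι → ℝ)) (hA : ∀ j a, ∃ f ∈ A j, f a ≠ 0) (s : Finset J)
    (hs : ¬ Splits (∏ j ∈ s, A j)) :
    ∑ j ∈ s, Module.finrank ℝ (A j) + 1 ≤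
      Module.finrank ℝ (∏ j ∈ s, A j : Submodule ℝ (ι → ℝ)) + s.card := by
  classical
  have hP : ∀ (s : Finset J) (a : ι), ∃ f ∈ ∏ j ∈ s, A j, f a ≠ 0 := by
    intro s a
    induction s using Finset.induction_on with
    | empty => exact ⟨1, by simp [Submodule.one_eq_span], by simp⟩
    | insert j s hj ih =>
      obtain ⟨f, hf, hfa⟩ := hA j a
      obtain ⟨g, hg, hga⟩ := ih
      exact ⟨f * g, by rw [Finset.prod_insert hj]; exact Submodule.mul_mem_mul hf hg,
        mul_ne_zero hfa hga⟩
  induction s using Finset.induction_on with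
  | empty =>
    rw [Finset.prod_empty, Submodule.one_eq_span, finrank_span_singleton one_ne_zero]
    simp
  | insert j s hj ih =>
    rw [Finset.prod_insert hj] at hs ⊢
    rw [Finset.sum_insert hj, Finset.card_insert_of_notMem hj]
    have h1 := ih fun h => hs (h.mul_left _)
    have h2 := finrank_add_finrank_le_finrank_mul (A j) (∏ j ∈ s, A j) (hA j) (hP s) hs
    omega

/-! ### Rank-one tensors and minimal vanishing sums -/

/-- The rank-one tensor with factors `y j`, one for each mode `j`. The index sets `κ j` may be
infinite, so that a function counts as a vector. -/
def prodTensor {J : Type*} [Fintype J] {κ : J → Type*} (y : ∀ j, κ j → ℝ) : (∀ j, κ j) → ℝ :=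
  fun i => ∏ j, y j (i j)

lemma ne_zero_of_prodTensor_ne_zero {J : Type*} [Fintype J] {κ : J → Type*} {y : ∀ j, κ j → ℝ}
    (h : prodTensor y ≠ 0) (j : J) : y j ≠ 0 := by
  rintro hj
  refine h (funext fun i => Finset.prod_eq_zero (Finset.mem_univ j) ?_)
  rw [hj, Pi.zero_apply]

lemma prodTensor_update {J : Type*} [Fintype J] [DecidableEq J] {κ : J → Type*}
    (y : ∀ j, κ j → ℝ) (i : ∀ j, κ j) (j : J) (k : κ j) :
    prodTensor y (Function.update i j k) = y j k * ∏ l ∈ Finset.univ.erase j, y l (i l) := by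
  rw [prodTensor, ← Finset.mul_prod_erase _ _ (Finset.mem_univ j), Function.update_self]
  congr 1
  refine Finset.prod_congr rfl fun l hl => ?_
  rw [Function.update_of_ne (Finset.ne_of_mem_erase hl)]

/-- The factors of a nonzero rank-one tensor are unique up to scaling. -/
theorem exists_smul_of_prodTensor_eq {J : Type*} [Fintype J] {κ : J → Type*}
    {y y' : ∀ j, κ j → ℝ} (h0 : prodTensor y ≠ 0) (h : prodTensor y' = prodTensor y) :
    ∃ c : J → ℝ, ∏ j, c j = 1 ∧ ∀ j, y' j = c j • y j := by
  classical
  obtain ⟨i, hi⟩ := Function.ne_iff.1 h0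
  have hi' : prodTensor y' i ≠ 0 := by rwa [h]
  have hy : ∀ j, y j (i j) ≠ 0 := fun j => Finset.prod_ne_zero_iff.1 hi j (Finset.mem_univ j)
  have hy' : ∀ j, y' j (i j) ≠ 0 := fun j => Finset.prod_ne_zero_iff.1 hi' j (Finset.mem_univ j)
  refine ⟨fun j => y' j (i j) / y j (i j), ?_, fun j => ?_⟩
  · rw [Finset.prod_div_distrib]
    exact (div_eq_one_iff_eq hi).2 (congrFun h i)
  · ext k
    have h1 := congrFun h (Function.update i j k)
    have h2 := congrFun h (Function.update i j (i j))
    rw [prodTensor_update, prodTensor_update] at h1 h2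
    have h3 : ∏ l ∈ Finset.univ.erase j, y' l (i l) ≠ 0 :=
      Finset.prod_ne_zero_iff.2 fun l _ => hy' l
    have h4 := hy j
    simp only [Pi.smul_apply, smul_eq_mul]
    rw [div_mul_eq_mul_div, eq_div_iff h4]
    refine mul_right_cancel₀ h3 ?_
    linear_combination y j (i j) * h1 - y j k * h2

/-- The row space of the matrix whose columns are the vectors `y a`. -/
def rowSpace {ι κ : Type*} (y : ι → κ → ℝ) : Submodule ℝ (ι → ℝ) :=
  Submodule.span ℝ (Set.range fun k a => y a k)

lemma finrank_rowSpace_comp_le {ι ι' κ : Type*} [Finite ι] (y : ι → κ → ℝ) (g : ι' → ι) :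
    Module.finrank ℝ (rowSpace fun a => y (g a)) ≤ Module.finrank ℝ (rowSpace y) := by
  have : (rowSpace fun a => y (g a)) = (rowSpace y).map (LinearMap.funLeft ℝ ℝ g) := by
    rw [rowSpace, rowSpace, Submodule.map_span, ← Set.range_comp]
    rfl
  rw [this]
  exact Submodule.finrank_map_le _ _

/-- Row rank is at least column rank. -/
lemma card_le_finrank_rowSpace {ι κ : Type*} [Fintype ι] {y : ι → κ → ℝ}
    (h : LinearIndependent ℝ y) : Fintype.card ι ≤ Module.finrank ℝ (rowSpace y) := by
  classical
  suffices rowSpace y = ⊤ by rw [this, finrank_top, Module.finrank_pi]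
  by_contra hne
  obtain ⟨f, hf, hle⟩ := Submodule.exists_le_ker_of_lt_top _ (lt_top_iff_ne_top.2 hne)
  refine hf (LinearMap.pi_ext' fun a => LinearMap.ext_ring ?_)
  refine Fintype.linearIndependent_iff.1 h (fun a => f (Pi.single a 1)) ?_ a
  ext k
  have hk : f (fun a => y a k) = 0 := hle (Submodule.subset_span ⟨k, rfl⟩)
  rw [LinearMap.pi_apply_eq_sum_univ] at hk
  rw [Finset.sum_apply, Pi.zero_apply, ← hk]
  refine Finset.sum_congr rfl fun a _ => ?_
  rw [Pi.smul_apply, smul_eq_mul, smul_eq_mul, mul_comm]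
  congr 2
  ext b
  simp [Pi.single_apply, eq_comm]

lemma finrank_rowSpace_smul_le_one {ι κ : Type*} [Finite ι] (c : ι → ℝ) (v : κ → ℝ) :
    Module.finrank ℝ (rowSpace fun a => c a • v) ≤ 1 := by
  have : (rowSpace fun a => c a • v) ≤ Submodule.span ℝ {c} := by
    refine Submodule.span_le.2 ?_
    rintro _ ⟨k, rfl⟩
    exact Submodule.mem_span_singleton.2 ⟨v k, by ext; simp [mul_comm]⟩
  refine (Submodule.finrank_mono this).trans ?_
  simpa using finrank_span_le_card (R := ℝ) {c}

open scoped Pointwise in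
/-- A vanishing combination of rank-one tensors of which no proper part vanishes has many terms. -/
theorem sum_finrank_rowSpace_add_two_le {ι J : Type*} [Fintype ι] [Nonempty ι] [Fintype J]
    {κ : J → Type*} (w : ι → ℝ) (y : ι → ∀ j, κ j → ℝ) (hw : ∀ a, w a ≠ 0) (h0 : ∀ a j, y a j ≠ 0)
    (hsum : ∑ a, w a • prodTensor (y a) = 0)
    (hmin : ∀ S : Finset ι, S.Nonempty → S ≠ Finset.univ → ∑ a ∈ S, w a • prodTensor (y a) ≠ 0) :
    ∑ j, Module.finrank ℝ (rowSpace fun a => y a j) + 2 ≤ Fintype.card ι + Fintype.card J := by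
  classical
  set P : Submodule ℝ (ι → ℝ) := ∏ j, rowSpace fun a => y a j with hP
  have hspan : P = Submodule.span ℝ (∏ j, Set.range fun k a => y a j k) := by
    rw [hP]; exact Submodule.prod_span _ _
  have hmem : ∀ i, (fun a => prodTensor (y a) i) ∈ P := by
    intro i
    have : (fun a => prodTensor (y a) i) = ∏ j, fun a => y a j (i j) := by
      ext a; simp [prodTensor]
    rw [this]
    rw [hspan]
    exact Submodule.subset_span ((Set.mem_finsetProd _ _ _).2 ⟨_, fun {j} _ => ⟨i j, rfl⟩, rfl⟩)
  have hker : ∀ p ∈ P, ∑ a, w a * p a = 0 := by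
    intro p hp
    rw [hspan] at hp
    induction hp using Submodule.span_induction with
    | mem p hp =>
      obtain ⟨g, hg, rfl⟩ := (Set.mem_finsetProd _ _ _).1 hp
      choose i hi using fun j => @hg j (Finset.mem_univ j)
      have := congrFun hsum i
      rw [Finset.sum_apply] at this
      rw [← this.trans (Pi.zero_apply i)]
      refine Finset.sum_congr rfl fun a _ => ?_
      simp [prodTensor, ← hi]
    | zero => simp
    | add p q _ _ hp hq => simp [mul_add, Finset.sum_add_distrib, hp, hq]
    | smul c p _ hp =>
      simp only [Pi.smul_apply, smul_eq_mul, mul_left_comm _ c, ← Finset.mul_sum, hp, mul_zero]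
  have hns : ¬ Splits P := by
    rintro ⟨S, hS, hS', h⟩
    refine hmin S.toFinset (by simpa using hS) (fun he => ?_) ?_
    · obtain ⟨a, ha⟩ := hS'
      exact ha (by simpa using he.ge (Finset.mem_univ a))
    · ext i
      have := hker _ (h _ (hmem i))
      rw [Finset.sum_apply, Pi.zero_apply, ← this, ← Finset.sum_subset (Finset.subset_univ _)]
      · refine Finset.sum_congr rfl fun a ha => ?_
        simp [Set.mem_toFinset.1 ha]
      · intro a _ ha
        rw [Set.indicator_of_notMem fun h => ha (Set.mem_toFinset.2 h), mul_zero]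
  have h1 := sum_finrank_le_finrank_prod (fun j => rowSpace fun a => y a j) (fun j a => by
    obtain ⟨k, hk⟩ := Function.ne_iff.1 (h0 a j)
    exact ⟨_, Submodule.subset_span ⟨k, rfl⟩, hk⟩) Finset.univ hns
  rw [← hP] at h1
  have h2 : Module.finrank ℝ P < Module.finrank ℝ (ι → ℝ) := by
    refine Submodule.finrank_lt fun htop => ?_
    obtain ⟨a⟩ := ‹Nonempty ι›
    have := hker (Pi.single a 1) (htop ▸ Submodule.mem_top)
    simp [Pi.single_apply, hw] at this
  rw [Module.finrank_pi] at h2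
  rw [Finset.card_univ] at h1
  omega

/-! ### Kruskal's theorem -/

/-- The two sides of an equation between sums of tensors, with the right-hand side negated. -/
noncomputable def signedTerm {ρ J : Type*} [Fintype J] {κ : J → Type*}
    (y y' : ρ → ∀ j, κ j → ℝ) : ρ ⊕ ρ → (∀ j, κ j) → ℝ :=
  Sum.elim (fun r => prodTensor (y r)) (fun r => -prodTensor (y' r))

lemma signedTerm_eq_smul {ρ J : Type*} [Fintype J] {κ : J → Type*}
    (y y' : ρ → ∀ j, κ j → ℝ) (a : ρ ⊕ ρ) :
    signedTerm y y' a = Sum.elim (fun _ => (1 : ℝ)) (fun _ => -1) a •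
      prodTensor (Sum.elim y y' a) := by
  rcases a with r | r <;> simp [signedTerm]

/-- `hdim` says that the factors of any set of terms `prodTensor (y r)` span large spaces. A part of the equation `∑ prodTensor (y r) = ∑ prodTensor (y' r)` without smaller parts
then has more terms on the right than on the left, or one term on the left. -/
lemma card_toLeft_lt_of_minimal {ρ J : Type*} [Fintype J] {κ : J → Type*}
    {y y' : ρ → ∀ j, κ j → ℝ} (h0 : ∀ r, prodTensor (y r) ≠ 0)
    (hdim : ∀ S : Finset ρ, 2 ≤ S.card → 2 * S.card + Fintype.card J ≤
      ∑ j, Module.finrank ℝ (rowSpace fun r : S => y r j) + 1)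
    {S : Finset (ρ ⊕ ρ)} (hS : S.Nonempty) (hsum : ∑ a ∈ S, signedTerm y y' a = 0)
    (hmin : ∀ T ⊂ S, T.Nonempty → ∑ a ∈ T, signedTerm y y' a ≠ 0) :
    S.toLeft.card < S.toRight.card ∨ S.toLeft.card = 1 ∧ 1 ≤ S.toRight.card := by
  classical
  have hcard := S.card_toLeft_add_card_toRight
  have hpos := hS.card_pos
  rcases lt_or_ge S.toLeft.card 2 with hlt | hge
  · by_cases h1 : S.toRight.card = 0
    · exfalso
      obtain ⟨a, ha⟩ := Finset.card_eq_one.1 (show S.card = 1 by omega)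
      rw [ha, Finset.sum_singleton] at hsum
      rcases a with r | r
      · exact h0 r hsum
      · have hr : r ∈ S.toRight := Finset.mem_toRight.2 (ha ▸ Finset.mem_singleton_self _)
        rw [Finset.card_eq_zero.1 h1] at hr
        exact Finset.notMem_empty r hr
    · omega
  · left
    have hterm : ∀ a ∈ S, signedTerm y y' a ≠ 0 := by
      intro a ha
      rw [← Finset.sum_singleton (signedTerm y y') a]
      refine hmin _ ⟨by simpa using ha, fun hle => ?_⟩ (Finset.singleton_nonempty a)
      have := Finset.card_le_card hle
      rw [Finset.card_singleton] at this
      omega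
    have : Nonempty S := hS.to_subtype
    have h1 := sum_finrank_rowSpace_add_two_le
      (fun a : S => Sum.elim (fun _ => (1 : ℝ)) (fun _ => -1) (a : ρ ⊕ ρ))
      (fun a : S => Sum.elim y y' (a : ρ ⊕ ρ))
      (by rintro ⟨r | r, hr⟩ <;> simp)
      (fun a => ne_zero_of_prodTensor_ne_zero fun h => hterm a a.2 (by
        rw [signedTerm_eq_smul, h, smul_zero]))
      (by
        simp only [← signedTerm_eq_smul]
        rw [Finset.sum_coe_sort S (signedTerm y y')]; exact hsum)
      (fun T hT hTS => by
        simp only [← signedTerm_eq_smul]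
        change ∑ a ∈ T, signedTerm y y' (Function.Embedding.subtype (· ∈ S) a) ≠ 0
        rw [← Finset.sum_map T (Function.Embedding.subtype (· ∈ S)) (signedTerm y y')]
        refine hmin _ (lt_of_le_of_ne (fun a ha => ?_) fun he => hTS ?_) (by simpa using hT)
        · obtain ⟨b, _, rfl⟩ := Finset.mem_map.1 ha; exact b.2
        · refine Finset.eq_univ_of_forall fun b => ?_
          have hb : (b : ρ ⊕ ρ) ∈ T.map (Function.Embedding.subtype (· ∈ S)) := (Finset.ext_iff.1 he b).2 b.2
          simpa using hb)
    have h2 := hdim S.toLeft hge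
    have h3 : ∑ j, Module.finrank ℝ (rowSpace fun r : S.toLeft => y r j) ≤
        ∑ j, Module.finrank ℝ (rowSpace fun a : S => Sum.elim y y' (a : ρ ⊕ ρ) j) :=
      Finset.sum_le_sum fun j _ => finrank_rowSpace_comp_le
        (fun a : S => Sum.elim y y' (a : ρ ⊕ ρ) j)
        (fun r : S.toLeft => (⟨Sum.inl r, Finset.mem_toLeft.1 r.2⟩ : S))
    rw [Fintype.card_coe] at h1
    omega

lemma card_toLeft_sdiff {α β : Type*} [DecidableEq α] [DecidableEq β] {S T : Finset (α ⊕ β)}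
    (h : T ⊆ S) :
    (S \ T).toLeft.card + T.toLeft.card = S.toLeft.card ∧
      (S \ T).toRight.card + T.toRight.card = S.toRight.card := by
  rw [Finset.toLeft_sdiff, Finset.toRight_sdiff]
  exact ⟨Finset.card_sdiff_add_card_eq_card (Finset.toLeft_subset_toLeft h),
    Finset.card_sdiff_add_card_eq_card (Finset.toRight_subset_toRight h)⟩

/-- Kruskal's theorem, for any number of modes, in the form that asks for large factor ranks on
every set of terms. -/
theorem exists_perm_of_sum_prodTensor_eq {ρ J : Type*} [Fintype ρ] [Fintype J] {κ : J → Type*}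
    {y y' : ρ → ∀ j, κ j → ℝ} (h0 : ∀ r, prodTensor (y r) ≠ 0)
    (hdim : ∀ S : Finset ρ, 2 ≤ S.card → 2 * S.card + Fintype.card J ≤
      ∑ j, Module.finrank ℝ (rowSpace fun r : S => y r j) + 1)
    (h : ∑ r, prodTensor (y r) = ∑ r, prodTensor (y' r)) :
    ∃ σ : Equiv.Perm ρ, ∀ r, prodTensor (y' r) = prodTensor (y (σ r)) := by
  classical
  set t := signedTerm y y' with ht
  have hdiff : ∀ S T : Finset (ρ ⊕ ρ), T ⊆ S → ∑ a ∈ S, t a = 0 → ∑ a ∈ T, t a = 0 →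
      ∑ a ∈ S \ T, t a = 0 := fun S T hTS hS hT => by
    rw [Finset.sum_sdiff_eq_sub hTS, hS, hT, sub_zero]
  have hle : ∀ n, ∀ S : Finset (ρ ⊕ ρ), S.card = n → ∑ a ∈ S, t a = 0 →
      S.toLeft.card ≤ S.toRight.card := by
    intro n
    induction n using Nat.strong_induction_on with
    | _ n ih =>
      intro S hn hS
      rcases S.eq_empty_or_nonempty with rfl | hne
      · exact le_of_eq rfl
      by_cases hmin : ∀ T ⊂ S, T.Nonempty → ∑ a ∈ T, t a ≠ 0
      · rcases card_toLeft_lt_of_minimal h0 hdim hne hS hmin with h | h <;> omega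
      · push Not at hmin
        obtain ⟨T, hTS, hT, hT0⟩ := hmin
        have h1 := card_toLeft_sdiff hTS.subset
        have h2 := ih _ (hn ▸ Finset.card_lt_card hTS) T rfl hT0
        have h3 := ih _ (hn ▸ Finset.card_lt_card (Finset.sdiff_ssubset hTS.subset hT)) (S \ T) rfl
          (hdiff S T hTS.subset hS hT0)
        omega
  have huniv : ∑ a, t a = 0 := by
    rw [Fintype.sum_sum_type]
    simp [ht, signedTerm, h]
  -- The complement of a vanishing part vanishes too, so equality holds.
  have heq : ∀ S : Finset (ρ ⊕ ρ), ∑ a ∈ S, t a = 0 → S.toLeft.card = S.toRight.card := by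
    intro S hS
    have h1 := card_toLeft_sdiff (Finset.subset_univ S)
    have h2 := hle _ S rfl hS
    have h3 := hle _ _ rfl (hdiff _ S (Finset.subset_univ S) huniv hS)
    have h4 : (Finset.univ : Finset (ρ ⊕ ρ)).toLeft.card =
      (Finset.univ : Finset (ρ ⊕ ρ)).toRight.card := by simp
    omega
  -- A minimal vanishing part that contains `r` consists of `r` and one term of the other side.
  have hpair : ∀ r, ∀ n, ∀ S : Finset (ρ ⊕ ρ), S.card = n → Sum.inl r ∈ S → ∑ a ∈ S, t a = 0 →
      ∃ r', prodTensor (y' r') = prodTensor (y r) := by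
    intro r n
    induction n using Nat.strong_induction_on with
    | _ n ih =>
      intro S hn hr hS
      by_cases hmin : ∀ T ⊂ S, T.Nonempty → ∑ a ∈ T, t a ≠ 0
      · have h1 := heq S hS
        have h2 := card_toLeft_lt_of_minimal h0 hdim ⟨_, hr⟩ hS hmin
        obtain ⟨r₁, hr₁⟩ := Finset.card_eq_one.1 (show S.toLeft.card = 1 by omega)
        obtain ⟨r', hr'⟩ := Finset.card_eq_one.1 (show S.toRight.card = 1 by omega)
        have hr₂ : r = r₁ := by simpa [hr₁] using Finset.mem_toLeft.2 hr
        refine ⟨r', ?_⟩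
        rw [← Finset.toLeft_disjSum_toRight (u := S), hr₁, hr', Finset.sum_disjSum] at hS
        simp only [ht, signedTerm, Finset.sum_singleton, Sum.elim_inl, Sum.elim_inr] at hS
        rw [hr₂]
        exact (sub_eq_zero.1 ((sub_eq_add_neg _ _).trans hS)).symm
      · push Not at hmin
        obtain ⟨T, hTS, hT, hT0⟩ := hmin
        by_cases hrT : Sum.inl r ∈ T
        · exact ih _ (hn ▸ Finset.card_lt_card hTS) T rfl hrT hT0
        · exact ih _ (hn ▸ Finset.card_lt_card (Finset.sdiff_ssubset hTS.subset hT)) (S \ T) rfl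
            (Finset.mem_sdiff.2 ⟨hr, hrT⟩) (hdiff S T hTS.subset hS hT0)
  choose τ hτ using fun r => hpair r _ _ rfl (Finset.mem_univ (Sum.inl r)) huniv
  have hinj : Function.Injective τ := by
    intro r₁ r₂ h12
    by_contra hne
    obtain ⟨c, -, hc⟩ := exists_smul_of_prodTensor_eq (h0 r₁)
      (show prodTensor (y r₂) = _ by rw [← hτ r₂, ← h12, hτ r₁])
    have h1 := hdim {r₁, r₂} (by rw [Finset.card_pair hne])
    have h2 : ∀ j, Module.finrank ℝ
        (rowSpace fun r : ({r₁, r₂} : Finset ρ) => y r j) ≤ 1 := by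
      intro j
      have : (fun r : ({r₁, r₂} : Finset ρ) => y r j) =
          fun r : ({r₁, r₂} : Finset ρ) => (if (r : ρ) = r₁ then (1 : ℝ) else c j) • y r₁ j := by
        funext ⟨r, hr⟩
        rcases eq_or_ne r r₁ with rfl | hr1
        · simp
        · have : r = r₂ := by simpa [hr1] using hr
          simp only [this, Ne.symm hne, if_false, hc]
      rw [this]
      exact finrank_rowSpace_smul_le_one _ _
    have h3 := Finset.sum_le_sum fun j (_ : j ∈ Finset.univ) => h2 j
    rw [Finset.card_pair hne] at h1
    simp only [Finset.sum_const, Finset.card_univ, smul_eq_mul, mul_one] at h3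
    omega
  let e : Equiv.Perm ρ := Equiv.ofBijective τ (Finite.injective_iff_bijective.1 hinj)
  refine ⟨e.symm, fun r => ?_⟩
  rw [← hτ]
  exact congrArg (fun r => prodTensor (y' r)) (e.apply_symm_apply r).symm

/-- The estimate by which the condition of Kruskal's theorem passes to smaller sets of terms:
`k ↦ min k s` is concave. -/
lemma two_mul_add_card_le_sum_min {J : Type*} [Fintype J] {R s : ℕ} {k : J → ℕ}
    (hk : ∀ j, 1 ≤ k j) (hkR : ∀ j, k j ≤ R) (hsum : 2 * R + Fintype.card J ≤ ∑ j, k j + 1)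
    (hs : 2 ≤ s) (hsR : s ≤ R) : 2 * s + Fintype.card J ≤ ∑ j, min (k j) s + 1 := by
  have h1 : ∀ j, ((s : ℤ) - 1) * (k j - 1) ≤ (R - 1) * ((min (k j) s : ℕ) - 1) := by
    intro j
    have h2 := hk j
    have h3 := hkR j
    rcases le_total (k j) s with h | h
    · rw [min_eq_left h]
      gcongr
      omega
    · rw [min_eq_right h, mul_comm]
      gcongr
      omega
  have h2 := Finset.sum_le_sum fun j (_ : j ∈ Finset.univ) => h1 j
  rw [← Finset.mul_sum, ← Finset.mul_sum, Finset.sum_sub_distrib, Finset.sum_sub_distrib] at h2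
  simp only [Finset.sum_const, Finset.card_univ, nsmul_eq_mul, mul_one] at h2
  rw [← Nat.cast_sum, ← Nat.cast_sum] at h2
  by_contra! hlt
  zify at *
  have h3 : ((s : ℤ) - 1) * (2 * R - 1) ≤ (s - 1) * (∑ j, (k j : ℤ) - Fintype.card J) := by
    refine mul_le_mul_of_nonneg_left ?_ (by omega)
    linarith
  have h4 : ((R : ℤ) - 1) * (∑ j, ((min (k j) s : ℕ) : ℤ) - Fintype.card J) ≤
      (R - 1) * (2 * s - 2) := by
    refine mul_le_mul_of_nonneg_left ?_ (by omega)
    push_cast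
    linarith
  push_cast at *
  nlinarith

/-- Kruskal's theorem for any number of modes. The number `k j` is a lower bound for the k-rank of
the factors of mode `j`. -/
theorem exists_perm_of_kruskal {ρ J : Type*} [Fintype ρ] [Fintype J] {κ : J → Type*}
    {y y' : ρ → ∀ j, κ j → ℝ} (h0 : ∀ r, prodTensor (y r) ≠ 0) (k : J → ℕ)
    (hk : ∀ j, 1 ≤ k j) (hkR : ∀ j, k j ≤ Fintype.card ρ)
    (hli : ∀ j, ∀ S : Finset ρ, S.card = k j → LinearIndependent ℝ (fun r : S => y r j))
    (hsum : 2 * Fintype.card ρ + Fintype.card J ≤ ∑ j, k j + 1)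
    (h : ∑ r, prodTensor (y r) = ∑ r, prodTensor (y' r)) :
    ∃ σ : Equiv.Perm ρ, ∀ r, prodTensor (y' r) = prodTensor (y (σ r)) := by
  classical
  refine exists_perm_of_sum_prodTensor_eq h0 (fun S hS => ?_) h
  have hSR : S.card ≤ Fintype.card ρ := S.card_le_univ
  refine (two_mul_add_card_le_sum_min hk hkR hsum hS hSR).trans
    (Nat.add_le_add_right (Finset.sum_le_sum fun j _ => ?_) 1)
  obtain ⟨T, hTS, U, hTU, hT, hU⟩ : ∃ T ⊆ S, ∃ U, T ⊆ U ∧ T.card = min (k j) S.card ∧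
      U.card = k j := by
    rcases le_total (k j) S.card with hle | hle
    · obtain ⟨T, hT, hc⟩ := Finset.exists_subset_card_eq hle
      exact ⟨T, hT, T, subset_rfl, by rw [hc, min_eq_left hle], hc⟩
    · obtain ⟨U, hU, hc⟩ := Finset.exists_superset_card_eq hle (hkR j)
      exact ⟨S, subset_rfl, U, hU, by rw [min_eq_right hle], hc⟩
  have h1 : LinearIndependent ℝ fun r : T => y r j :=
    (hli j U hU).comp (fun r : T => (⟨r, hTU r.2⟩ : U)) fun a b hab =>
      Subtype.ext (congrArg (fun r : U => (r : ρ)) hab)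
  have h2 := card_le_finrank_rowSpace h1
  rw [Fintype.card_coe, hT] at h2
  exact h2.trans (finrank_rowSpace_comp_le (fun r : S => y r j)
    (fun r : T => (⟨r, hTS r.2⟩ : S)))

/-! ### Broadcasted representations and k-ranks -/

lemma eq_zero_of_forall_add_sum_eq_zero {I : Type*} [Fintype I] (G : I → C(unitInterval, ℝ))
    (hG : ∀ i, G i ∈ meanZeroFunctions) (c : ℝ)
    (h : ∀ X : I → unitInterval, c + ∑ i, G i (X i) = 0) : c = 0 ∧ ∀ i, G i = 0 := by
  classical
  have hz : ∀ i, G i = 0 := by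
    intro i
    -- Varying only the entry `i` shows that `G i` is constant.
    have hc : ∀ x, G i x = G i 0 := by
      intro x
      have h1 := h (Function.update (0 : I → unitInterval) i x)
      have h2 := h 0
      rw [← Finset.add_sum_erase _ _ (Finset.mem_univ i)] at h1 h2
      have h3 : ∑ j ∈ Finset.univ.erase i, G j (Function.update (0 : I → unitInterval) i x j) =
          ∑ j ∈ Finset.univ.erase i, G j ((0 : I → unitInterval) j) :=
        Finset.sum_congr rfl fun j hj => by rw [Function.update_of_ne (Finset.ne_of_mem_erase hj)]
      rw [h3, Function.update_self] at h1
      simp only [Pi.zero_apply] at h1 h2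
      linarith
    have h0 : ∫ x : unitInterval, G i x = 0 := hG i
    simp only [hc, integral_const, probReal_univ, one_smul] at h0
    ext x
    rw [hc, h0, ContinuousMap.zero_apply]
  exact ⟨by simpa [hz] using h 0, hz⟩

lemma meanZeroFunctions_sum_smul {ρ : Type*} [Fintype ρ] {f : ρ → C(unitInterval, ℝ)}
    (hf : ∀ r, f r ∈ meanZeroFunctions) (w : ρ → ℝ) : ∑ r, w r • f r ∈ meanZeroFunctions := by
  have hi : ∀ g : C(unitInterval, ℝ), Integrable (fun x => g x) := fun g =>
    g.continuous.integrable_of_hasCompactSupport (HasCompactSupport.of_compactSpace _)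
  change ∫ x, (∑ r, w r • f r) x = 0
  simp only [ContinuousMap.sum_apply, ContinuousMap.smul_apply]
  rw [integral_finsetSum (f := fun r x => w r • f r x) _ fun r _ => (hi (f r)).smul (w r)]
  refine Finset.sum_eq_zero fun r _ => ?_
  rw [integral_smul, show ∫ x, f r x = 0 from hf r, smul_zero]

lemma broadcastedModel_eq {D : ℕ} {p : Fin D → ℕ} {R : ℕ} (ν : ℝ) (β : Coeffs p R)
    (f : Fin R → C(unitInterval, ℝ)) (X : Covariate p) :
    broadcastedModel ν β f X =
      ν + ∑ i, ((1 / ∏ d, (p d : ℝ)) • ∑ r, outerProduct (β r) i • f r) (X i) := by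
  simp only [broadcastedModel, tensorInner, broadcast, ContinuousMap.smul_apply,
    ContinuousMap.sum_apply, smul_eq_mul]
  rw [← Finset.mul_sum, Finset.sum_comm]

/-- A broadcasted model determines its intercept and its functional coefficient tensor. -/
lemma IsRepresentation.eq_and_sum_eq {D : ℕ} {p : Fin D → ℕ} (hp : ∀ d, 0 < p d) {R R' : ℕ}
    {m : Covariate p → ℝ} {ν ν' : ℝ} {β : Coeffs p R} {β' : Coeffs p R'}
    {f : Fin R → C(unitInterval, ℝ)} {f' : Fin R' → C(unitInterval, ℝ)}
    (h : IsRepresentation m ν β f) (h' : IsRepresentation m ν' β' f') :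
    ν = ν' ∧ ∀ i, ∑ r, outerProduct (β r) i • f r = ∑ r, outerProduct (β' r) i • f' r := by
  set s : ℝ := 1 / ∏ d, (p d : ℝ) with hs
  have hs0 : s ≠ 0 := one_div_ne_zero
    (Finset.prod_ne_zero_iff.2 fun d _ => Nat.cast_ne_zero.2 (hp d).ne')
  let w : (∀ d, Fin (p d)) → Fin R ⊕ Fin R' → ℝ := fun i =>
    Sum.elim (fun r => s * outerProduct (β r) i) (fun r => -(s * outerProduct (β' r) i))
  have hw : ∀ i, ∑ a, w i a • Sum.elim f f' a =
      s • ((∑ r, outerProduct (β r) i • f r) - ∑ r, outerProduct (β' r) i • f' r) := by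
    intro i
    simp [w, Fintype.sum_sum_type, Finset.smul_sum, mul_smul, sub_eq_add_neg]
  obtain ⟨h1, h2⟩ := eq_zero_of_forall_add_sum_eq_zero
    (fun i => ∑ a, w i a • Sum.elim f f' a)
    (fun i => meanZeroFunctions_sum_smul (Sum.forall.2 ⟨h.1, h'.1⟩) _) (ν - ν') (fun X => by
      have h3 := h.2 X
      rw [h'.2 X, broadcastedModel_eq, broadcastedModel_eq, ← hs] at h3
      simp only [hw, smul_sub, ContinuousMap.sub_apply, Finset.sum_sub_distrib]
      linarith)
  refine ⟨sub_eq_zero.1 h1, fun i => sub_eq_zero.1 ?_⟩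
  have h3 := h2 i
  rw [hw, smul_eq_zero] at h3
  exact h3.resolve_left hs0

/-- The modes of a coefficient tensor with values in functions: one for each mode of the
covariate tensor, with index set `Fin (p d)`, and one for the function, with index set `[0,1]`. -/
def ModeIndex {D : ℕ} (p : Fin D → ℕ) : Option (Fin D) → Type
  | none => unitInterval
  | some d => Fin (p d)

/-- The factors of one component, the function being the factor of the last mode. -/
def modeFactors {D : ℕ} {p : Fin D → ℕ} (b : ∀ d, Fin (p d) → ℝ) (f : C(unitInterval, ℝ)) :
    ∀ j, ModeIndex p j → ℝ
  | none => f
  | some d => b d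

lemma prodTensor_modeFactors {D : ℕ} {p : Fin D → ℕ} (b : ∀ d, Fin (p d) → ℝ)
    (f : C(unitInterval, ℝ)) (i : ∀ j, ModeIndex p j) :
    prodTensor (modeFactors b f) i = outerProduct b (fun d => i (some d)) * f (i none) := by
  rw [prodTensor, Fintype.prod_option, mul_comm]
  rfl

lemma sum_prodTensor_modeFactors_eq {D : ℕ} {p : Fin D → ℕ} {R : ℕ} {β β' : Coeffs p R}
    {f f' : Fin R → C(unitInterval, ℝ)}
    (h : ∀ i, ∑ r, outerProduct (β r) i • f r = ∑ r, outerProduct (β' r) i • f' r) :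
    ∑ r, prodTensor (modeFactors (β r) (f r)) = ∑ r, prodTensor (modeFactors (β' r) (f' r)) := by
  ext i
  have key : ∀ x : unitInterval, ∑ r, outerProduct (β r) (fun d => i (some d)) * f r x =
      ∑ r, outerProduct (β' r) (fun d => i (some d)) * f' r x := fun x => by
    simpa [ContinuousMap.sum_apply] using DFunLike.congr_fun (h fun d => i (some d)) x
  rw [Finset.sum_apply, Finset.sum_apply]
  simp only [prodTensor_modeFactors]
  exact key (i none)

lemma SameUpToPermScaling.of_prodTensor_eq {D : ℕ} {p : Fin D → ℕ} {R : ℕ} {β β' : Coeffs p R}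
    {f f' : Fin R → C(unitInterval, ℝ)} (h0 : ∀ r, prodTensor (modeFactors (β r) (f r)) ≠ 0)
    (σ : Equiv.Perm (Fin R)) (h : ∀ r, prodTensor (modeFactors (β' r) (f' r)) =
      prodTensor (modeFactors (β (σ r)) (f (σ r)))) :
    SameUpToPermScaling β f β' f' := by
  choose c hc hc' using fun r => exists_smul_of_prodTensor_eq (h0 (σ r)) (h r)
  refine ⟨σ, fun r d => c r (some d), fun r => c r none, fun r => ⟨?_, fun d => ?_, ?_⟩⟩
  · rw [← hc r, Fintype.prod_option, mul_comm]
  · exact hc' r (some d)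
  · exact DFunLike.coe_injective (hc' r none)

lemma prodTensor_modeFactors_ne_zero_of_isMinimal {D R : ℕ} {p : Fin D → ℕ} {m : Covariate p → ℝ}
    {ν : ℝ} {β : Coeffs p R} {f : Fin R → C(unitInterval, ℝ)}
    (h : IsMinimalRepresentation m ν β f) (r : Fin R) :
    prodTensor (modeFactors (β r) (f r)) ≠ 0 := by
  intro h0
  cases R with
  | zero => exact r.elim0
  | succ n =>
    refine h.2.1 n n.lt_succ_self ⟨ν, fun a => β (r.succAbove a), fun a => f (r.succAbove a),
      fun a => h.1.1 _, fun X => ?_⟩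
    rw [h.1.2 X, broadcastedModel, broadcastedModel, Fin.sum_univ_succAbove _ r]
    have : tensorInner (outerProduct (β r)) (broadcast (f r) X) = 0 := by
      refine Finset.sum_eq_zero fun i _ => ?_
      have := congrFun h0 (fun | none => X i | some d => i d)
      rwa [prodTensor_modeFactors] at this
    rw [this, zero_add]

lemma isUniqueRepresentation_zero {D : ℕ} {p : Fin D → ℕ} {m : Covariate p → ℝ}
    {ν : ℝ} {β : Coeffs p 0} {f : Fin 0 → C(unitInterval, ℝ)}
    (h : IsRepresentation m ν β f) : IsUniqueRepresentation m ν β f := by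
  refine ⟨h, fun ν' β' f' h' => ⟨?_, Equiv.refl _, fun r => r.elim0, fun r => r.elim0,
    fun r => r.elim0⟩⟩
  have h1 := h.2 fun _ => 0
  rw [h'.2] at h1
  simpa [broadcastedModel] using h1.symm

lemma kRank_mem {n R : ℕ} (B : Matrix (Fin n) (Fin R) ℝ) :
    kRank B ≤ R ∧ ∀ S : Finset (Fin R), S.card = kRank B →
      LinearIndependent ℝ (fun r : S => B.col r) := by
  refine Nat.sSup_mem (s := {k | k ≤ R ∧ ∀ S : Finset (Fin R), S.card = k →
    LinearIndependent ℝ (fun r : S => B.col r)}) ⟨0, Nat.zero_le _, fun S hS => ?_⟩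
    ⟨R, fun k hk => hk.1⟩
  have : IsEmpty S := by rw [Finset.card_eq_zero.1 hS]; infer_instance
  exact linearIndependent_empty_type

lemma one_le_kRank {n R : ℕ} (hR : 1 ≤ R) {B : Matrix (Fin n) (Fin R) ℝ}
    (hB : ∀ r, B.col r ≠ 0) : 1 ≤ kRank B := by
  refine le_csSup ⟨R, fun k hk => hk.1⟩ ⟨hR, fun S hS => ?_⟩
  obtain ⟨r, rfl⟩ := Finset.card_eq_one.1 hS
  exact LinearIndependent.of_subsingleton (⟨r, Finset.mem_singleton_self r⟩ : ({r} : Finset (Fin R)))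
    (hB r)

lemma linearIndependent_coe {ρ : Type*} {f : ρ → C(unitInterval, ℝ)}
    (hf : LinearIndependent ℝ f) : LinearIndependent ℝ fun r => (f r : unitInterval → ℝ) :=
  hf.map' (ContinuousMap.coeFnLinearMap ℝ)
    (LinearMap.ker_eq_bot.2 DFunLike.coe_injective)

/-- Kruskal's condition for broadcasted representations; `k` and `l` are lower bounds for the
k-ranks of the coefficients and of the functions. -/
theorem isUniqueRepresentation_of_kruskal {D R : ℕ} {p : Fin D → ℕ} {m : Covariate p → ℝ}
    {ν : ℝ} {β : Coeffs p R} {f : Fin R → C(unitInterval, ℝ)} (hp : ∀ d, 0 < p d)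
    (h : IsRepresentation m ν β f) (h0 : ∀ r, prodTensor (modeFactors (β r) (f r)) ≠ 0)
    (k : Fin D → ℕ) (l : ℕ) (hk : ∀ d, 1 ≤ k d) (hl : 1 ≤ l) (hkR : ∀ d, k d ≤ R) (hlR : l ≤ R)
    (hβ : ∀ d, ∀ S : Finset (Fin R), S.card = k d → LinearIndependent ℝ (fun r : S => β r d))
    (hf : ∀ S : Finset (Fin R), S.card = l → LinearIndependent ℝ (fun r : S => f r))
    (hsum : 2 * R + D ≤ ∑ d, k d + l) : IsUniqueRepresentation m ν β f := by
  refine ⟨h, fun ν' β' f' h' => ?_⟩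
  obtain ⟨h1, h2⟩ := h.eq_and_sum_eq hp h'
  refine ⟨h1, ?_⟩
  obtain ⟨σ, hσ⟩ := exists_perm_of_kruskal h0 (fun j => j.elim l k)
    (Option.forall.2 ⟨hl, hk⟩) (by rw [Fintype.card_fin]; exact Option.forall.2 ⟨hlR, hkR⟩)
    (Option.forall.2 ⟨fun S hS => linearIndependent_coe (hf S hS), hβ⟩)
    (by
      rw [Fintype.sum_option, Fintype.card_option, Fintype.card_fin, Fintype.card_fin]
      simp only [Option.elim]
      omega)
    (sum_prodTensor_modeFactors_eq h2)
  exact .of_prodTensor_eq h0 σ hσ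

lemma pos_of_prodTensor_ne_zero {D : ℕ} {p : Fin D → ℕ} {b : ∀ d, Fin (p d) → ℝ}
    {f : C(unitInterval, ℝ)} (h : prodTensor (modeFactors b f) ≠ 0) (d : Fin D) : 0 < p d := by
  obtain ⟨i, -⟩ := Function.ne_iff.1 h
  exact Fin.pos (i (some d))

/-- Both conditions on k-ranks are instances of this one, with `l` the k-rank of the functions. -/
theorem IsMinimalRepresentation.isUnique_of_kRank {D R : ℕ} {p : Fin D → ℕ} {m : Covariate p → ℝ}
    {ν : ℝ} {β : Coeffs p R} {f : Fin R → C(unitInterval, ℝ)}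
    (h : IsMinimalRepresentation m ν β f) (l : ℕ) (hl : 1 ≤ R → 1 ≤ l) (hlR : 1 ≤ R → l ≤ R)
    (hf : ∀ S : Finset (Fin R), S.card = l → LinearIndependent ℝ (fun r : S => f r))
    (hsum : 2 * R + D ≤ ∑ d, kRank (factorMatrix β d) + l) : IsUniqueRepresentation m ν β f := by
  rcases R.eq_zero_or_pos with rfl | hR
  · exact isUniqueRepresentation_zero h.1
  have h0 := prodTensor_modeFactors_ne_zero_of_isMinimal h
  exact isUniqueRepresentation_of_kruskal (pos_of_prodTensor_ne_zero (h0 ⟨0, hR⟩)) h.1 h0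
    (fun d => kRank (factorMatrix β d)) l
    (fun d => one_le_kRank hR fun r => ne_zero_of_prodTensor_ne_zero (h0 r) (some d))
    (hl hR) (fun d => (kRank_mem _).1) (hlR hR) (fun d S hS => (kRank_mem _).2 S hS) hf hsum

theorem IsMinimalRepresentation.isUnique_of_general {D R : ℕ} {p : Fin D → ℕ}
    {m : Covariate p → ℝ} {ν : ℝ} {β : Coeffs p R} {f : Fin R → C(unitInterval, ℝ)}
    (h : IsMinimalRepresentation m ν β f)
    (hsum : 2 * R + D ≤ ∑ d, kRank (factorMatrix β d) + 1) : IsUniqueRepresentation m ν β f := by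
  refine h.isUnique_of_kRank 1 (fun _ => le_rfl) id (fun S hS => ?_) hsum
  obtain ⟨r, rfl⟩ := Finset.card_eq_one.1 hS
  refine LinearIndependent.of_subsingleton
    (⟨r, Finset.mem_singleton_self r⟩ : ({r} : Finset (Fin R))) fun hr => ?_
  exact ne_zero_of_prodTensor_ne_zero (prodTensor_modeFactors_ne_zero_of_isMinimal h r) none
    (by simp only [modeFactors]; rw [hr]; rfl)

theorem IsMinimalRepresentation.isUnique_of_linearIndependent {D R : ℕ} {p : Fin D → ℕ}
    {m : Covariate p → ℝ} {ν : ℝ} {β : Coeffs p R} {f : Fin R → C(unitInterval, ℝ)}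
    (h : IsMinimalRepresentation m ν β f) (hf : LinearIndependent ℝ f)
    (hsum : R + D ≤ ∑ d, kRank (factorMatrix β d)) : IsUniqueRepresentation m ν β f :=
  h.isUnique_of_kRank R id (fun _ => le_rfl) (fun _ _ => hf.comp _ Subtype.val_injective)
    (by omega)

/-! ### Algebraically independent numbers -/

open scoped IntermediateField.algebraAdjoinAdjoin in
lemma formallyEtale_adjoin_of_isTranscendenceBasis {ι : Type*} {x : ι → ℝ}
    (hx : IsTranscendenceBasis ℚ x) :
    Algebra.FormallyEtale (Algebra.adjoin ℚ (Set.range x)) ℝ := by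
  have h1 : Algebra.FormallyEtale (Algebra.adjoin ℚ (Set.range x))
      (IntermediateField.adjoin ℚ (Set.range x)) :=
    .of_isLocalization (nonZeroDivisors _)
  have := hx.isAlgebraic_field
  have h2 : Algebra.FormallyEtale (IntermediateField.adjoin ℚ (Set.range x)) ℝ :=
    Algebra.FormallyEtale.of_isSeparable _ ℝ
  exact .comp _ (IntermediateField.adjoin ℚ (Set.range x)) _

/-- Derivations extend from the polynomial ring generated by a transcendence basis, as `ℝ` is formally
étale over that ring. -/
lemma exists_derivation_of_isTranscendenceBasis {ι : Type*} {x : ι → ℝ}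
    (hx : IsTranscendenceBasis ℚ x) (v : ι → ℝ) :
    ∃ δ : Derivation ℚ ℝ ℝ, ∀ i, δ (x i) = v i := by
  have := formallyEtale_adjoin_of_isTranscendenceBasis hx
  let e := hx.1.aevalEquiv
  let _ : Algebra (MvPolynomial ι ℚ) ℝ := (MvPolynomial.aeval x).toAlgebra
  have hsmul : ∀ (q : MvPolynomial ι ℚ) (c : ℝ), q • c = (e q : ℝ) * c := fun q c => by
    rw [Algebra.smul_def]; congr 1
  have : IsScalarTower ℚ (MvPolynomial ι ℚ) ℝ := .of_algebraMap_eq fun c => ((MvPolynomial.aeval x).commutes c).symm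
  let δ₀ : Derivation ℚ (MvPolynomial ι ℚ) ℝ := MvPolynomial.mkDerivation ℚ v
  let δ₁ : Derivation ℚ (Algebra.adjoin ℚ (Set.range x)) ℝ :=
    Derivation.mk' (δ₀.toLinearMap ∘ₗ e.symm.toLinearMap) fun a b => by
      simp [hsmul, Algebra.smul_def]
  let g := (KaehlerDifferential.isBaseChange_of_formallyEtale ℚ
    (Algebra.adjoin ℚ (Set.range x)) ℝ).lift δ₁.liftKaehlerDifferential
  refine ⟨g.compDer (KaehlerDifferential.D ℚ ℝ), fun i => ?_⟩
  have hi : x i = algebraMap (Algebra.adjoin ℚ (Set.range x)) ℝ (e (MvPolynomial.X i)) := by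
    simp [e]
  have h1 : g (KaehlerDifferential.D ℚ ℝ
      (algebraMap (Algebra.adjoin ℚ (Set.range x)) ℝ (e (MvPolynomial.X i)))) = v i := by
    rw [← KaehlerDifferential.map_D ℚ ℚ, IsBaseChange.lift_eq,
      Derivation.liftKaehlerDifferential_comp_D]
    simp [δ₁, δ₀]
  rw [← hi] at h1
  exact h1

/-- Algebraically independent numbers can be moved independently by derivations. -/
theorem AlgebraicIndependent.exists_derivation {ι : Type*} {x : ι → ℝ}
    (hx : AlgebraicIndependent ℚ x) (v : ι → ℝ) :
    ∃ δ : Derivation ℚ ℝ ℝ, ∀ i, δ (x i) = v i := by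
  classical
  obtain ⟨t, hxt, ht⟩ := exists_isTranscendenceBasis_superset (AlgebraicIndependent.to_subtype_range hx)
  obtain ⟨δ, hδ⟩ := exists_derivation_of_isTranscendenceBasis ht
    (fun a => if h : ∃ i, x i = a then v h.choose else 0)
  refine ⟨δ, fun i => ?_⟩
  have h := hδ ⟨x i, hxt ⟨i, rfl⟩⟩
  have hi : ∃ i', x i' = x i := ⟨i, rfl⟩
  rw [dif_pos hi, hx.injective hi.choose_spec] at h
  exact h

lemma natDegree_and_coeff_prod_line {σ : Type*} (y v : σ → ℝ) (s : σ → ℕ) (T : Finset σ) :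
    (∏ i ∈ T, (Polynomial.C (y i) + Polynomial.C (v i) * Polynomial.X) ^ s i).natDegree ≤
        ∑ i ∈ T, s i ∧
      (∏ i ∈ T, (Polynomial.C (y i) + Polynomial.C (v i) * Polynomial.X) ^ s i).coeff
        (∑ i ∈ T, s i) = ∏ i ∈ T, v i ^ s i := by
  classical
  have h1 : ∀ i, (Polynomial.C (y i) + Polynomial.C (v i) * Polynomial.X).natDegree ≤ 1 := by
    intro i; compute_degree
  have h2 : ∀ i, ((Polynomial.C (y i) + Polynomial.C (v i) * Polynomial.X) ^ s i).natDegree ≤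
      s i := fun i => Polynomial.natDegree_pow_le_of_le _ (h1 i) |>.trans (by simp)
  induction T using Finset.induction_on with
  | empty => simp
  | insert a T ha ih =>
    rw [Finset.prod_insert ha, Finset.sum_insert ha, Finset.prod_insert ha]
    refine ⟨Polynomial.natDegree_mul_le_of_le (h2 a) ih.1, ?_⟩
    rw [Polynomial.coeff_mul_add_eq_of_natDegree_le (h2 a) ih.1, ih.2]
    congr 1
    have := Polynomial.coeff_pow_of_natDegree_le (n := 1) (m := s a) (h1 a)
    rw [mul_one] at this
    rw [this]
    simp

/-- The coefficient of `t ^ n` in `P (y + t v)`, where `n` bounds the degree of `P`, is the value at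
`v` of the component of `P` of degree `n`. -/
lemma coeff_aeval_line {σ : Type*} [Fintype σ] (P : MvPolynomial σ ℝ) {n : ℕ}
    (hn : P.totalDegree ≤ n) (y v : σ → ℝ) :
    (MvPolynomial.aeval (fun i => Polynomial.C (y i) + Polynomial.C (v i) * Polynomial.X) P).coeff n
      = MvPolynomial.eval v (MvPolynomial.homogeneousComponent n P) := by
  classical
  rw [MvPolynomial.aeval_def, MvPolynomial.eval₂_eq', MvPolynomial.homogeneousComponent_apply,
    map_sum, Polynomial.finsetSum_coeff, Finset.sum_filter]
  refine Finset.sum_congr rfl fun s hs => ?_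
  have hdeg : s.degree = ∑ i, s i := Finsupp.degree_eq_sum s
  have hle : s.degree ≤ n := (MvPolynomial.le_totalDegree hs).trans hn
  obtain ⟨h1, h2⟩ := natDegree_and_coeff_prod_line y v s Finset.univ
  rw [← hdeg] at h1 h2
  rw [← Polynomial.C_eq_algebraMap, Polynomial.coeff_C_mul]
  split_ifs with h
  · rw [← h, h2, MvPolynomial.eval_monomial, Finsupp.prod_fintype _ _ fun i => pow_zero _]
  · rw [Polynomial.coeff_eq_zero_of_natDegree_lt (by omega), mul_zero]

/-- The zero set of a nonzero polynomial is a null set. -/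
lemma ae_eval_ne_zero {σ E : Type*} [Finite σ] [NormedAddCommGroup E] [NormedSpace ℝ E]
    [FiniteDimensional ℝ E] [MeasurableSpace E] [BorelSpace E] (μ : Measure E)
    [μ.IsAddHaarMeasure] (e : E ≃ₗ[ℝ] (σ → ℝ)) {P : MvPolynomial σ ℝ} (hP : P ≠ 0) :
    ∀ᵐ z ∂μ, MvPolynomial.eval (e z) P ≠ 0 := by
  have := Fintype.ofFinite σ
  have hcont : Continuous fun z => MvPolynomial.eval (e z) P :=
    (MvPolynomial.continuous_eval P).comp e.toLinearMap.continuous_of_finiteDimensional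
  have hh : MvPolynomial.homogeneousComponent P.totalDegree P ≠ 0 := by
    obtain ⟨s, hs, hd⟩ := Finset.exists_mem_eq_sup P.support
      (Finset.nonempty_of_ne_empty fun h => hP (MvPolynomial.support_eq_empty.1 h))
      fun s => s.sum fun _ e => e
    intro h
    have h1 := congrArg (MvPolynomial.coeff s) h
    rw [MvPolynomial.coeff_homogeneousComponent, if_pos] at h1
    · exact MvPolynomial.mem_support_iff.1 hs h1
    · exact hd.symm
  obtain ⟨v, hv⟩ : ∃ v, MvPolynomial.eval v
      (MvPolynomial.homogeneousComponent P.totalDegree P) ≠ 0 := by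
    by_contra! h
    exact hh (MvPolynomial.funext fun v => by rw [h v, map_zero])
  -- On every line with direction `v` the polynomial has only finitely many zeros.
  refine ae_mem_of_ae_add_linearMap_mem (s := {z | MvPolynomial.eval (e z) P ≠ 0})
    (LinearMap.toSpanSingleton ℝ E (e.symm v)) volume μ
    (isOpen_ne.preimage hcont).measurableSet fun y => ?_
  set Q : Polynomial ℝ := MvPolynomial.aeval
    (fun i => Polynomial.C (e y i) + Polynomial.C (v i) * Polynomial.X) P with hQ
  have hQ0 : Q ≠ 0 := fun h => hv (by
    rw [← coeff_aeval_line P le_rfl (e y) v, ← hQ, h, Polynomial.coeff_zero])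
  have hQe : ∀ t, Q.eval t = MvPolynomial.eval (e (y + t • e.symm v)) P := by
    intro t
    rw [hQ, ← Polynomial.coe_evalRingHom, MvPolynomial.aeval_def, MvPolynomial.hom_eval₂]
    change _ = MvPolynomial.eval₂ (RingHom.id ℝ) _ P
    congr 1
    · ext c; exact Polynomial.eval_C
    · ext i
      simp only [Polynomial.coe_evalRingHom,
        Polynomial.eval_mul, Polynomial.eval_C, Polynomial.eval_X, map_add, map_smul,
        LinearEquiv.apply_symm_apply, Pi.add_apply, Pi.smul_apply, smul_eq_mul]
      ring
  refine Filter.mem_of_superset (compl_mem_ae_iff.2 ((Q.rootSet_finite ℝ).measure_zero volume))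
    fun t ht h0 => ht ?_
  refine (Polynomial.mem_rootSet_of_ne hQ0).2 ?_
  rw [Polynomial.coe_aeval_eq_eval, hQe]
  exact h0

/-- Almost all points have algebraically independent coordinates. -/
theorem ae_algebraicIndependent {σ E : Type*} [Finite σ] [NormedAddCommGroup E] [NormedSpace ℝ E]
    [FiniteDimensional ℝ E] [MeasurableSpace E] [BorelSpace E] (μ : Measure E)
    [μ.IsAddHaarMeasure] (e : E ≃ₗ[ℝ] (σ → ℝ)) :
    ∀ᵐ z ∂μ, AlgebraicIndependent ℚ (e z) := by
  have : Countable (MvPolynomial σ ℚ) := by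
    rw [← Cardinal.mk_le_aleph0_iff]
    refine MvPolynomial.cardinalMk_le_max_lift.trans ?_
    simp
  have h : ∀ P : {P : MvPolynomial σ ℚ // P ≠ 0}, ∀ᵐ z ∂μ,
      MvPolynomial.aeval (e z) (P : MvPolynomial σ ℚ) ≠ 0 := by
    rintro ⟨P, hP⟩
    have hP' : MvPolynomial.map (algebraMap ℚ ℝ) P ≠ 0 := fun h0 =>
      hP (MvPolynomial.map_injective _ (algebraMap ℚ ℝ).injective (by rw [h0, map_zero]))
    filter_upwards [ae_eval_ne_zero μ e hP'] with z hz
    rwa [MvPolynomial.eval_map] at hz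
  filter_upwards [ae_all_iff.2 h] with z hz
  rw [algebraicIndependent_iff]
  intro P hP
  by_contra h0
  exact hz ⟨P, h0⟩ hP

/-- The coordinates of a coefficient family. -/
def coeffsEquiv {D : ℕ} (p : Fin D → ℕ) (R : ℕ) :
    Coeffs p R ≃ₗ[ℝ] ((Fin R × Σ d, Fin (p d)) → ℝ) where
  toFun β t := β t.1 t.2.1 t.2.2
  map_add' _ _ := rfl
  map_smul' _ _ := rfl
  invFun z r d i := z (r, ⟨d, i⟩)
  left_inv _ := rfl
  right_inv _ := rfl

theorem ae_algebraicIndependent_coeffs {D : ℕ} (p : Fin D → ℕ) (R : ℕ) :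
    ∀ᵐ β : Coeffs p R ∂volume, AlgebraicIndependent ℚ
      fun t : Fin R × Σ d, Fin (p d) => β t.1 t.2.1 t.2.2 := by
  have h1 : ∀ d, (volume : Measure (Fin (p d) → ℝ)).IsAddHaarMeasure := fun d => inferInstance
  have h2 : (volume : Measure (∀ d, Fin (p d) → ℝ)).IsAddHaarMeasure :=
    Measure.pi.isAddHaarMeasure _
  have h3 : (volume : Measure (Coeffs p R)).IsAddHaarMeasure :=
    Measure.pi.isAddHaarMeasure _
  exact ae_algebraicIndependent volume (coeffsEquiv p R)

/-! ### Tangent spaces to the variety of rank-one tensors -/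

section HammingBalls

variable {J : Type*} [Fintype J] {κ : J → Type*} [∀ j, Fintype (κ j)]

/-- The union of the Hamming balls of radius one around the points of `C`. -/
noncomputable def hammingNhds (C : Finset (∀ j, κ j)) : Finset (∀ j, κ j) :=
  open Classical in {i | ∃ c ∈ C, ∃ j, ∀ l ≠ j, i l = c l}

lemma mem_hammingNhds {C : Finset (∀ j, κ j)} {i : ∀ j, κ j} :
    i ∈ hammingNhds C ↔ ∃ c ∈ C, ∃ j, ∀ l ≠ j, i l = c l := by
  simp [hammingNhds]

lemma hammingNhds_mono {C C' : Finset (∀ j, κ j)} (h : C ⊆ C') :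
    hammingNhds C ⊆ hammingNhds C' := fun i hi => by
  obtain ⟨c, hc, hi⟩ := mem_hammingNhds.1 hi
  exact mem_hammingNhds.2 ⟨c, h hc, hi⟩

lemma subset_hammingNhds [Nonempty J] (C : Finset (∀ j, κ j)) : C ⊆ hammingNhds C := fun i hi =>
  mem_hammingNhds.2 ⟨i, hi, Classical.arbitrary J, fun _ _ => rfl⟩

lemma card_hammingNhds_singleton [Nonempty J] (o : ∀ j, κ j) :
    (hammingNhds {o}).card = 1 + ∑ j, (Fintype.card (κ j) - 1) := by
  classical
  let g : Option (Σ j, {k : κ j // k ≠ o j}) → ∀ j, κ j :=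
    fun t => t.elim o fun s => Function.update o s.1 s.2
  have hg : Function.Injective g := by
    rintro (_ | ⟨j, k, hk⟩) (_ | ⟨j', k', hk'⟩) h
    · rfl
    · exact absurd (by simpa [g] using congrFun h.symm j') hk'
    · exact absurd (by simpa [g] using congrFun h j) hk
    · have h1 := congrFun h j
      simp only [g, Option.elim, Function.update_self] at h1
      rcases eq_or_ne j j' with rfl | hne
      · rw [Function.update_self] at h1
        subst h1
        rfl
      · rw [Function.update_of_ne hne] at h1
        exact absurd h1 hk
  have himg : hammingNhds {o} = Finset.univ.image g := by
    ext i
    simp only [mem_hammingNhds, Finset.mem_singleton, exists_eq_left, Finset.mem_image,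
      Finset.mem_univ, true_and]
    constructor
    · rintro ⟨j, hj⟩
      by_cases hij : i j = o j
      · refine ⟨none, funext fun l => ?_⟩
        rcases eq_or_ne l j with rfl | hl
        · exact hij.symm
        · exact (hj l hl).symm
      · refine ⟨some ⟨j, i j, hij⟩, funext fun l => ?_⟩
        rcases eq_or_ne l j with rfl | hl
        · simp [g]
        · simp [g, hl, hj l hl]
    · rintro ⟨_ | ⟨j, k, hk⟩, rfl⟩
      · exact ⟨Classical.arbitrary J, fun _ _ => rfl⟩
      · exact ⟨j, fun l hl => by simp [g, hl]⟩
  rw [himg, Finset.card_image_of_injective _ hg, Finset.card_univ, Fintype.card_option,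
    Fintype.card_sigma, add_comm]
  congr 1
  refine Finset.sum_congr rfl fun j _ => ?_
  simp [Fintype.card_subtype_compl]

/-- If there are two points outside a Hamming ball of radius one, then there are two neighbouring
ones: change one coordinate of one of the points to that of the other. -/
lemma exists_adjacent_notMem_hammingNhds {o i i' : ∀ j, κ j} (hne : i ≠ i')
    (hi : i ∉ hammingNhds {o}) (hi' : i' ∉ hammingNhds {o}) :
    ∃ e e', e ≠ e' ∧ e ∉ hammingNhds {o} ∧ e' ∉ hammingNhds {o} ∧ e' ∈ hammingNhds {e} := by
  classical
  simp only [mem_hammingNhds, Finset.mem_singleton, exists_eq_left, not_exists, not_forall] at *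
  by_cases h : ∃ d, i d ≠ i' d ∧ i' d ≠ o d
  · obtain ⟨d, hd, hd'⟩ := h
    refine ⟨i, Function.update i d (i' d), fun he => hd ?_, hi, fun j => ?_, d, fun l hl => ?_⟩
    · simpa using congrFun he d
    · obtain ⟨l, hl, hlo⟩ := hi j
      refine ⟨l, hl, ?_⟩
      rcases eq_or_ne l d with rfl | hld
      · simpa using hd'
      · simpa [hld] using hlo
    · simp [hl]
  · push Not at h
    obtain ⟨d, hd⟩ := Function.ne_iff.1 hne
    have hd' : i' d = o d := h d hd
    refine ⟨i', Function.update i' d (i d), fun he => hd ?_, hi', fun j => ?_, d, fun l hl => ?_⟩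
    · simpa using (congrFun he d).symm
    · obtain ⟨l, hl, hlo⟩ := hi' j
      refine ⟨l, hl, ?_⟩
      rcases eq_or_ne l d with rfl | hld
      · exact absurd hd' hlo
      · simpa [hld] using hlo
    · simp [hl]

/-- Few Hamming balls of radius one may cover many points: the second ball contributes at least two
new points, and each later ball at least one. -/
lemma exists_le_card_hammingNhds [Nonempty J] {m : ℕ} (hm : 2 ≤ m)
    (hle : m + (1 + ∑ j, (Fintype.card (κ j) - 1)) ≤ ∏ j, Fintype.card (κ j)) :
    ∃ C : Finset (∀ j, κ j), C.card ≤ m ∧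
      m + (1 + ∑ j, (Fintype.card (κ j) - 1)) ≤ (hammingNhds C).card := by
  classical
  induction m, hm using Nat.le_induction with
  | base =>
    rw [← Fintype.card_pi] at hle
    obtain ⟨o⟩ : Nonempty (∀ j, κ j) := Fintype.card_pos_iff.1 (by omega)
    have hc := card_hammingNhds_singleton o
    have hcompl : 1 < (hammingNhds {o})ᶜ.card := by rw [Finset.card_compl]; omega
    obtain ⟨i, hi, i', hi', hne⟩ := Finset.one_lt_card.1 hcompl
    obtain ⟨e, e', hee, he, he', hn⟩ := exists_adjacent_notMem_hammingNhds hne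
      (Finset.mem_compl.1 hi) (Finset.mem_compl.1 hi')
    refine ⟨{o, e}, Finset.card_le_two, ?_⟩
    have hsub : insert e (insert e' (hammingNhds {o})) ⊆ hammingNhds {o, e} := by
      refine Finset.insert_subset (subset_hammingNhds _ (by simp))
        (Finset.insert_subset (hammingNhds_mono (by simp) hn) (hammingNhds_mono (by simp)))
    have := Finset.card_le_card hsub
    rw [Finset.card_insert_of_notMem (by simp [hee, he]), Finset.card_insert_of_notMem he'] at this
    omega
  | succ m hm ih =>
    obtain ⟨C, hC, hCm⟩ := ih (by omega)
    by_cases hu : hammingNhds C = Finset.univ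
    · refine ⟨C, by omega, ?_⟩
      rw [hu, Finset.card_univ, Fintype.card_pi]
      exact hle
    · obtain ⟨i, hi⟩ : ∃ i, i ∉ hammingNhds C := by
        by_contra! h
        exact hu (Finset.eq_univ_of_forall h)
      refine ⟨insert i C, (Finset.card_insert_le _ _).trans (by omega), ?_⟩
      have := Finset.card_le_card (Finset.insert_subset
        (subset_hammingNhds (insert i C) (Finset.mem_insert_self i C))
        (hammingNhds_mono (Finset.subset_insert i C)))
      rw [Finset.card_insert_of_notMem hi] at this
      omega

end HammingBalls

lemma derivation_prod {J : Type*} [DecidableEq J] (δ : Derivation ℚ ℝ ℝ) (g : J → ℝ) (s : Finset J) :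
    δ (∏ j ∈ s, g j) = ∑ j ∈ s, δ (g j) * ∏ l ∈ s.erase j, g l := by
  induction s using Finset.induction_on with
  | empty => simp
  | insert a s ha ih =>
    rw [Finset.prod_insert ha, Derivation.leibniz, ih, Finset.sum_insert ha,
      Finset.erase_insert ha, smul_eq_mul, smul_eq_mul, Finset.mul_sum, add_comm]
    congr 1
    · ring
    · refine Finset.sum_congr rfl fun j hj => ?_
      have hja : j ≠ a := fun h => ha (h ▸ hj)
      rw [Finset.erase_insert_of_ne hja.symm, Finset.prod_insert (by simp [ha])]
      ring

section Tangents

variable {J : Type*} [Fintype J] [DecidableEq J] {κ : J → Type*}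

/-- The map `v ↦ a_1 ∘ ⋯ ∘ v ∘ ⋯ ∘ a_D` that replaces the factor of mode `j` by `v`. The ranges of
these maps span the tangent space at `prodTensor a` to the variety of rank-one tensors. -/
def replaceFactor (a : ∀ j, κ j → ℝ) (j : J) : (κ j → ℝ) →ₗ[ℝ] ((∀ j, κ j) → ℝ) where
  toFun v i := v (i j) * ∏ l ∈ Finset.univ.erase j, a l (i l)
  map_add' v w := by ext; simp [add_mul]
  map_smul' c v := by ext; simp [mul_assoc]

lemma replaceFactor_self (a : ∀ j, κ j → ℝ) (j : J) : replaceFactor a j (a j) = prodTensor a := by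
  ext i
  exact Finset.mul_prod_erase Finset.univ (fun l => a l (i l)) (Finset.mem_univ j)

lemma derivation_prodTensor (δ : Derivation ℚ ℝ ℝ) (a : ∀ j, κ j → ℝ) (i : ∀ j, κ j) :
    δ (prodTensor a i) = ∑ j, replaceFactor a j (fun k => δ (a j k)) i :=
  derivation_prod δ (fun j => a j (i j)) Finset.univ

/-- A differentiated equation: if the derivations of `ℝ` move `y = ∑ c_r x_r` only within `W`, then
the tangent spaces at the `x_r` lie in the sum of `W` and the span of the `x_r`. -/
lemma range_replaceFactor_le {ρ : Type*} [Fintype ρ] {β : ρ → ∀ j, κ j → ℝ}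
    (hβ : AlgebraicIndependent ℚ fun t : ρ × Σ j, κ j => β t.1 t.2.1 t.2.2)
    {c : ρ → ℝ} (hc : ∀ r, c r ≠ 0) {y : (∀ j, κ j) → ℝ}
    (hy : ∑ r, c r • prodTensor (β r) = y) {W : Submodule ℝ ((∀ j, κ j) → ℝ)}
    (hW : ∀ δ : Derivation ℚ ℝ ℝ, (fun i => δ (y i)) ∈ W) (r : ρ) (j : J) :
    LinearMap.range (replaceFactor (β r) j) ≤
      Submodule.span ℝ (Set.range fun r => prodTensor (β r)) ⊔ W := by
  classical
  rintro _ ⟨v, rfl⟩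
  obtain ⟨δ, hδ⟩ := hβ.exists_derivation fun t =>
    if t.1 = r then (if h : t.2.1 = j then v (h ▸ t.2.2) else 0) else 0
  have h1 : ∀ r' j', replaceFactor (β r') j' (fun k => δ (β r' j' k)) =
      if r' = r ∧ j' = j then replaceFactor (β r) j v else 0 := by
    intro r' j'
    have hv : (fun k => δ (β r' j' k)) = fun k =>
        if r' = r then (if h : j' = j then v (h ▸ k) else 0) else 0 :=
      funext fun k => hδ (r', ⟨j', k⟩)
    rw [hv]
    by_cases hr : r' = r
    · by_cases hj : j' = j
      · subst hr hj; simp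
      · simp only [hr, hj, if_true, dif_neg, not_false_eq_true, and_false, if_false]
        exact map_zero _
    · simp only [hr, if_false, false_and]
      exact map_zero _
  have h2 : (fun i => δ (y i)) = ∑ r', δ (c r') • prodTensor (β r') + c r • replaceFactor (β r) j v := by
    ext i
    rw [← hy]
    simp only [Finset.sum_apply, Pi.add_apply, Pi.smul_apply, map_sum, smul_eq_mul,
      Derivation.leibniz, derivation_prodTensor, h1, Finset.sum_add_distrib]
    rw [add_comm]
    congr 1
    · exact Finset.sum_congr rfl fun r' _ => mul_comm _ _
    · rw [Finset.sum_eq_single r (fun r' _ hr' => by simp [hr']) (by simp),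
        Finset.sum_eq_single j (fun j' _ hj' => by simp [hj']) (by simp)]
      simp
  have h3 : replaceFactor (β r) j v = (c r)⁻¹ • ((fun i => δ (y i)) -
      ∑ r', δ (c r') • prodTensor (β r')) := by
    rw [h2, add_sub_cancel_left, inv_smul_smul₀ (hc r)]
  rw [h3]
  refine Submodule.smul_mem _ _ (Submodule.sub_mem _ (Submodule.mem_sup_right (hW δ))
    (Submodule.mem_sup_left (Submodule.sum_mem _ fun r' _ => Submodule.smul_mem _ _
      (Submodule.subset_span ⟨r', rfl⟩))))

variable [∀ j, Fintype (κ j)]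

/-- The tangent spaces at rank-one tensors with algebraically independent factors span a space whose
dimension is at least the number of points covered by Hamming balls of radius one: for factors from
the standard bases, the tangent spaces are spanned by the basis tensors in such balls. -/
lemma card_hammingNhds_le_finrank {ρ : Type*} {β : ρ → ∀ j, κ j → ℝ}
    (hβ : AlgebraicIndependent ℚ fun t : ρ × Σ j, κ j => β t.1 t.2.1 t.2.2)
    (C : Finset (∀ j, κ j)) (r : (∀ j, κ j) → ρ) (hr : Set.InjOn r C)
    {T : Submodule ℝ ((∀ j, κ j) → ℝ)} (hT : ∀ r j, LinearMap.range (replaceFactor (β r) j) ≤ T) :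
    (hammingNhds C).card ≤ Module.finrank ℝ T := by
  classical
  choose c hc j hj using fun i : hammingNhds C => mem_hammingNhds.1 i.2
  -- A minor of the matrix of tangent vectors, as a matrix of polynomials in the coefficients.
  let M : Matrix (hammingNhds C) (hammingNhds C) (MvPolynomial (ρ × Σ j, κ j) ℚ) :=
    Matrix.of fun i i' => if i.1 (j i') = i'.1 (j i') then
      ∏ l ∈ Finset.univ.erase (j i'), MvPolynomial.X (r (c i'), ⟨l, i.1 l⟩) else 0
  let w : hammingNhds C → (∀ j, κ j) → ℝ := fun i' =>
    replaceFactor (β (r (c i'))) (j i') (Pi.single (i'.1 (j i')) 1)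
  -- At the point where `c` belongs to the component `r c` the minor is the identity matrix.
  have hM1 : (MvPolynomial.aeval fun t : ρ × Σ j, κ j =>
      if ∃ c ∈ C, r c = t.1 ∧ c t.2.1 = t.2.2 then (1 : ℚ) else 0).mapMatrix M = 1 := by
    ext i i'
    simp only [M, AlgHom.mapMatrix_apply, Matrix.map_apply, Matrix.of_apply, Matrix.one_apply]
    have hex : ∀ l k, (∃ c₁ ∈ C, r c₁ = r (c i') ∧ c₁ l = k) ↔ c i' l = k := fun l k =>
      ⟨fun ⟨c₁, h1, h2, h3⟩ => by rw [← hr h1 (hc i') h2]; exact h3,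
        fun h => ⟨c i', hc i', rfl, h⟩⟩
    by_cases h : i.1 (j i') = i'.1 (j i')
    · rw [if_pos h, map_prod]
      simp only [MvPolynomial.aeval_X, hex]
      split_ifs with hii
      · subst hii
        refine Finset.prod_eq_one fun l hl => ?_
        rw [if_pos (hj i l (Finset.ne_of_mem_erase hl)).symm]
      · obtain ⟨l, hl⟩ := Function.ne_iff.1 fun h => hii (Subtype.ext h)
        have hlj : l ≠ j i' := fun hlj => hl (hlj ▸ h)
        refine Finset.prod_eq_zero (Finset.mem_erase.2 ⟨hlj, Finset.mem_univ l⟩) ?_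
        rw [if_neg]
        rw [← hj i' l hlj]
        exact fun h => hl h.symm
    · rw [if_neg h, map_zero, if_neg fun hii => h (by rw [hii])]
  have hdet : M.det ≠ 0 := by
    intro h0
    have := congrArg Matrix.det hM1
    rw [← AlgHom.map_det, h0, map_zero, Matrix.det_one] at this
    exact zero_ne_one this
  have hMβ : ((MvPolynomial.aeval fun t : ρ × Σ j, κ j => β t.1 t.2.1 t.2.2).mapMatrix M) =
      Matrix.of fun i i' : hammingNhds C => w i' i.1 := by
    ext i i'
    simp only [M, AlgHom.mapMatrix_apply, Matrix.map_apply, Matrix.of_apply, w, replaceFactor,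
      LinearMap.coe_mk, AddHom.coe_mk, Pi.single_apply]
    split_ifs with h
    · rw [map_prod, one_mul]
      simp only [MvPolynomial.aeval_X]
    · rw [map_zero, zero_mul]
  have hdetβ : (Matrix.of fun i i' : hammingNhds C => w i' i.1).det ≠ 0 := by
    rw [← hMβ, ← AlgHom.map_det]
    exact fun h => hdet (hβ (by rw [h, map_zero]))
  have hw : LinearIndependent ℝ w := by
    have h1 := Matrix.linearIndependent_cols_iff_isUnit.2
      ((Matrix.isUnit_iff_isUnit_det _).2 (isUnit_iff_ne_zero.2 hdetβ))
    exact LinearIndependent.of_comp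
      (LinearMap.funLeft ℝ ℝ (Subtype.val : hammingNhds C → ∀ j, κ j)) h1
  have hspan : Submodule.span ℝ (Set.range w) ≤ T := by
    refine Submodule.span_le.2 ?_
    rintro _ ⟨i, rfl⟩
    exact hT _ _ ⟨_, rfl⟩
  have := Submodule.finrank_mono hspan
  rwa [finrank_span_eq_card hw, Fintype.card_coe] at this

/-- A space spanned by `ρ` vectors and the tangent space at one of its rank-one tensors. -/
lemma finrank_sup_tangent_le {ρ : Type*} [Fintype ρ] (x : ρ → (∀ j, κ j) → ℝ) {a : ∀ j, κ j → ℝ}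
    (ha : ∀ j, a j ≠ 0) (hax : prodTensor a ∈ Submodule.span ℝ (Set.range x)) :
    Module.finrank ℝ (Submodule.span ℝ (Set.range x) ⊔ ⨆ j, LinearMap.range (replaceFactor a j) :
      Submodule ℝ ((∀ j, κ j) → ℝ)) ≤ Fintype.card ρ + ∑ j, (Fintype.card (κ j) - 1) := by
  classical
  choose o ho using fun j => Function.ne_iff.1 (ha j)
  -- Since `replaceFactor a j (a j)` is in the span, one basis vector of each mode is not needed.
  let g : ρ ⊕ (Σ j, {k : κ j // k ≠ o j}) → (∀ j, κ j) → ℝ :=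
    Sum.elim x fun t => replaceFactor a t.1 (Pi.single t.2.1 1)
  have hle : (Submodule.span ℝ (Set.range x) ⊔ ⨆ j, LinearMap.range (replaceFactor a j) :
      Submodule ℝ ((∀ j, κ j) → ℝ)) ≤ Submodule.span ℝ (Set.range g) := by
    have hx : Submodule.span ℝ (Set.range x) ≤ Submodule.span ℝ (Set.range g) :=
      Submodule.span_mono (by rintro _ ⟨r, rfl⟩; exact ⟨Sum.inl r, rfl⟩)
    refine sup_le hx (iSup_le fun j => ?_)
    have hne : ∀ k ≠ o j, replaceFactor a j (Pi.single k 1) ∈ Submodule.span ℝ (Set.range g) :=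
      fun k hk => Submodule.subset_span ⟨Sum.inr ⟨j, k, hk⟩, rfl⟩
    have hsum : ∀ v : κ j → ℝ, replaceFactor a j v = v (o j) • replaceFactor a j (Pi.single (o j) 1) +
        ∑ k ∈ Finset.univ.erase (o j), v k • replaceFactor a j (Pi.single k 1) := by
      intro v
      rw [Finset.add_sum_erase _ (fun k => v k • replaceFactor a j (Pi.single k 1))
        (Finset.mem_univ _)]
      simp only [← map_smul, ← map_sum]
      congr 1
      exact pi_eq_sum_univ' v
    have herase : ∀ v : κ j → ℝ, ∑ k ∈ Finset.univ.erase (o j),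
        v k • replaceFactor a j (Pi.single k 1) ∈ Submodule.span ℝ (Set.range g) := fun v =>
      Submodule.sum_mem _ fun k hk => Submodule.smul_mem _ _ (hne k (Finset.ne_of_mem_erase hk))
    have ho' : replaceFactor a j (Pi.single (o j) 1) ∈ Submodule.span ℝ (Set.range g) := by
      have h1 := hsum (a j)
      rw [replaceFactor_self] at h1
      rw [← Submodule.smul_mem_iff _ (ho j), eq_sub_of_add_eq h1.symm]
      exact Submodule.sub_mem _ (hx hax) (herase _)
    rintro _ ⟨v, rfl⟩
    rw [hsum v]
    exact Submodule.add_mem _ (Submodule.smul_mem _ _ ho') (herase v)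
  refine (Submodule.finrank_mono hle).trans ((finrank_range_le_card g).trans ?_)
  rw [Fintype.card_sum, Fintype.card_sigma]
  simp [Fintype.card_subtype_compl]

/-- The generic trisecant lemma for rank-one tensors: at most as many rank-one tensors as the
codimension of the variety of rank-one tensors, with algebraically independent factors, have no
rank-one tensor in their span except for their multiples. -/
theorem sum_smul_prodTensor_ne {ρ : Type*} [Fintype ρ] [Nonempty J] {β : ρ → ∀ j, κ j → ℝ}
    (hβ : AlgebraicIndependent ℚ fun t : ρ × Σ j, κ j => β t.1 t.2.1 t.2.2)
    (hρ : 2 ≤ Fintype.card ρ)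
    (hle : Fintype.card ρ + (1 + ∑ j, (Fintype.card (κ j) - 1)) ≤ ∏ j, Fintype.card (κ j))
    {c : ρ → ℝ} (hc : ∀ r, c r ≠ 0) (a : ∀ j, κ j → ℝ) :
    ∑ r, c r • prodTensor (β r) ≠ prodTensor a := by
  classical
  intro h
  obtain ⟨C, hC, hCn⟩ := exists_le_card_hammingNhds hρ hle
  obtain ⟨ρ₀⟩ : Nonempty ρ := Fintype.card_pos_iff.1 (by omega)
  obtain ⟨r, hr⟩ : ∃ r : (∀ j, κ j) → ρ, Set.InjOn r C := by
    obtain ⟨r⟩ := Function.Embedding.nonempty_of_card_le (α := C) (β := ρ)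
      (by rwa [Fintype.card_coe])
    refine ⟨fun i => if hi : i ∈ C then r ⟨i, hi⟩ else ρ₀, fun i hi i' hi' hii => ?_⟩
    simp only [Finset.mem_coe.1 hi, Finset.mem_coe.1 hi', dif_pos] at hii
    exact congrArg Subtype.val (r.injective hii)
  have hmem : prodTensor a ∈ Submodule.span ℝ (Set.range fun r => prodTensor (β r)) := by
    rw [← h]
    exact Submodule.sum_mem _ fun r' _ => Submodule.smul_mem _ _ (Submodule.subset_span ⟨r', rfl⟩)
  rcases eq_or_ne (prodTensor a) 0 with h0 | h0
  · have h1 := card_hammingNhds_le_finrank hβ C r hr (range_replaceFactor_le hβ hc (h.trans h0)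
      (W := ⊥) fun δ => by simp only [Pi.zero_apply, map_zero]; exact zero_mem _)
    rw [sup_bot_eq] at h1
    have h2 := finrank_range_le_card (R := ℝ) fun r => prodTensor (β r)
    rw [Set.finrank] at h2
    omega
  · have h1 := card_hammingNhds_le_finrank hβ C r hr (range_replaceFactor_le hβ hc h
      (W := ⨆ j, LinearMap.range (replaceFactor a j)) fun δ => by
        have : (fun i => δ (prodTensor a i)) = ∑ j, replaceFactor a j fun k => δ (a j k) := by
          ext i; rw [derivation_prodTensor, Finset.sum_apply]
        rw [this]
        exact Submodule.sum_mem _ fun j _ => Submodule.mem_iSup_of_mem j ⟨_, rfl⟩)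
    have h2 := finrank_sup_tangent_le _ (ne_zero_of_prodTensor_ne_zero h0) hmem
    omega

end Tangents

/-! ### Generic coefficients -/

section Generic

variable {D R : ℕ} {p : Fin D → ℕ} {β : Coeffs p R}

lemma prodTensor_ne_zero_of_algebraicIndependent (hp : ∀ d, 0 < p d)
    (hβ : AlgebraicIndependent ℚ fun t : Fin R × Σ d, Fin (p d) => β t.1 t.2.1 t.2.2)
    (r : Fin R) : prodTensor (β r) ≠ 0 := by
  intro h
  have := congrFun h fun d => ⟨0, hp d⟩
  refine Finset.prod_ne_zero_iff.2 (fun d _ => ?_) this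
  exact hβ.ne_zero (r, ⟨d, ⟨0, hp d⟩⟩)

lemma eq_of_sum_smul_prodTensor_eq [Nonempty (Fin D)]
    (hβ : AlgebraicIndependent ℚ fun t : Fin R × Σ d, Fin (p d) => β t.1 t.2.1 t.2.2)
    (hR : 2 ≤ R → R + (1 + ∑ d, (p d - 1)) ≤ ∏ d, p d) {c : Fin R → ℝ} {a : ∀ d, Fin (p d) → ℝ}
    (h : ∑ r, c r • prodTensor (β r) = prodTensor a) {r r' : Fin R} (hr : c r ≠ 0)
    (hr' : c r' ≠ 0) : r = r' := by
  classical
  by_contra hne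
  have h2 : 2 ≤ Fintype.card {r // c r ≠ 0} :=
    Fintype.one_lt_card_iff.2 ⟨⟨r, hr⟩, ⟨r', hr'⟩, fun h => hne (congrArg Subtype.val h)⟩
  have hle : Fintype.card {r // c r ≠ 0} ≤ R :=
    (Fintype.card_subtype_le _).trans_eq (Fintype.card_fin R)
  have hR' := hR (h2.trans hle)
  refine sum_smul_prodTensor_ne (ρ := {r // c r ≠ 0}) (β := fun r => β r)
    (hβ.comp (fun t : {r // c r ≠ 0} × Σ d, Fin (p d) => (t.1.1, t.2)) ?_) h2 ?_
    (fun r => r.2) a ?_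
  · rintro ⟨⟨r, hr⟩, t⟩ ⟨⟨r', hr'⟩, t'⟩ h
    simp only [Prod.mk.injEq] at h
    obtain ⟨rfl, rfl⟩ := h
    rfl
  · simp only [Fintype.card_fin]
    omega
  · rw [← h, ← Fintype.sum_subtype_add_sum_subtype (fun r => c r ≠ 0), left_eq_add]
    exact Finset.sum_eq_zero fun r _ => by rw [not_not.1 r.2, zero_smul]

lemma linearIndependent_prodTensor [Nonempty (Fin D)] (hp : ∀ d, 0 < p d)
    (hβ : AlgebraicIndependent ℚ fun t : Fin R × Σ d, Fin (p d) => β t.1 t.2.1 t.2.2)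
    (hR : 2 ≤ R → R + (1 + ∑ d, (p d - 1)) ≤ ∏ d, p d) :
    LinearIndependent ℝ fun r => prodTensor (β r) := by
  refine Fintype.linearIndependent_iff.2 fun c hc r => ?_
  by_contra hr
  have h0 : ∑ r, c r • prodTensor (β r) = prodTensor (0 : ∀ d, Fin (p d) → ℝ) := by
    rw [hc]
    by_contra h
    exact ne_zero_of_prodTensor_ne_zero (Ne.symm h) (Classical.arbitrary _) rfl
  rw [Finset.sum_eq_single r (fun r' _ hr' => ?_) (by simp)] at hc
  · exact (smul_ne_zero hr (prodTensor_ne_zero_of_algebraicIndependent hp hβ r)) hc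
  · by_contra h
    exact hr' (eq_of_sum_smul_prodTensor_eq hβ hR h0 (left_ne_zero_of_smul h) hr)

/-- For algebraically independent coefficients and linearly independent functions, the coefficient
tensors are, up to scaling, the rank-one tensors in the span that the model determines. -/
theorem isUniqueRepresentation_of_algebraicIndependent [Nonempty (Fin D)] (hp : ∀ d, 0 < p d)
    (hβ : AlgebraicIndependent ℚ fun t : Fin R × Σ d, Fin (p d) => β t.1 t.2.1 t.2.2)
    (hR : 2 ≤ R → R + (1 + ∑ d, (p d - 1)) ≤ ∏ d, p d) {m : Covariate p → ℝ} {ν : ℝ}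
    {f : Fin R → C(unitInterval, ℝ)} (hf : LinearIndependent ℝ f)
    (h : IsRepresentation m ν β f) : IsUniqueRepresentation m ν β f := by
  classical
  refine ⟨h, fun ν' β' f' h' => ?_⟩
  obtain ⟨hν, hsum⟩ := h.eq_and_sum_eq hp h'
  refine ⟨hν, ?_⟩
  set x := fun r => prodTensor (β r)
  set x' := fun r => prodTensor (β' r)
  have hsum' : ∀ i, ∑ r, x r i • f r = ∑ r, x' r i • f' r := hsum
  have hxli : LinearIndependent ℝ x := linearIndependent_prodTensor hp hβ hR
  -- Functionals dual to the functions show that the two families of tensors have the same span.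
  obtain ⟨g, hg⟩ := LinearMap.exists_leftInverse_of_injective (Finsupp.linearCombination ℝ f)
    (LinearMap.ker_eq_bot.2 hf)
  have hgf : ∀ s, g (f s) = Finsupp.single s 1 := fun s => by
    have := LinearMap.congr_fun hg (Finsupp.single s 1)
    simpa using this
  have hle : Submodule.span ℝ (Set.range x) ≤ Submodule.span ℝ (Set.range x') := by
    refine Submodule.span_le.2 ?_
    rintro _ ⟨r, rfl⟩
    have : x r = ∑ s, g (f' s) r • x' s := by
      ext i
      have h1 := congrArg (fun F => g F r) (hsum' i)
      simp only [map_sum, map_smul, hgf, Finsupp.finsetSum_apply, Finsupp.smul_apply,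
        Finsupp.single_apply, smul_eq_mul, mul_ite, mul_one, mul_zero, Finset.sum_ite_eq',
        Finset.mem_univ, if_true] at h1
      rw [h1, Finset.sum_apply]
      exact Finset.sum_congr rfl fun s _ => mul_comm _ _
    rw [this]
    exact Submodule.sum_mem _ fun s _ => Submodule.smul_mem _ _ (Submodule.subset_span ⟨s, rfl⟩)
  have hxfin : Module.finrank ℝ (Submodule.span ℝ (Set.range x)) = R := by
    rw [finrank_span_eq_card hxli, Fintype.card_fin]
  have hxfin' : Module.finrank ℝ (Submodule.span ℝ (Set.range x')) ≤ R :=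
    (finrank_range_le_card (R := ℝ) x').trans_eq (Fintype.card_fin R)
  have hspan := Submodule.eq_of_le_of_finrank_le hle (by omega)
  have hxli' : LinearIndependent ℝ x' :=
    linearIndependent_iff_card_eq_finrank_span.2 (by
      rw [Set.finrank, ← hspan, hxfin, Fintype.card_fin])
  -- Hence each tensor of the second family is a multiple of one of the first.
  have hmul : ∀ s, ∃ r, ∃ t : ℝ, t ≠ 0 ∧ x' s = t • x r := by
    intro s
    have hs : x' s ∈ Submodule.span ℝ (Set.range x) := hspan ▸ Submodule.subset_span ⟨s, rfl⟩
    obtain ⟨c, hc⟩ := (Submodule.mem_span_range_iff_exists_fun ℝ).1 hs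
    obtain ⟨r, hr⟩ : ∃ r, c r ≠ 0 := by
      by_contra! h0
      exact hxli'.ne_zero s (by rw [← hc]; simp [h0])
    refine ⟨r, c r, hr, ?_⟩
    rw [← hc]
    refine Finset.sum_eq_single r (fun r' _ hr' => ?_) (by simp)
    by_contra h
    exact hr' (eq_of_sum_smul_prodTensor_eq hβ hR hc (left_ne_zero_of_smul h) hr)
  choose σ t ht hσ using hmul
  have hinj : Function.Injective σ := by
    intro s s' hss
    by_contra hne
    have h1 : t s' • x' s - t s • x' s' = 0 := by
      rw [hσ s, hσ s', hss, smul_smul, smul_smul, mul_comm, sub_self]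
    have h2 := Fintype.linearIndependent_iff.1 hxli'
      (Pi.single s (t s') - Pi.single s' (t s)) (by
        simp only [Pi.sub_apply, sub_smul, Finset.sum_sub_distrib]
        rw [Finset.sum_eq_single s (fun b _ hb => by simp [hb]) (by simp),
          Finset.sum_eq_single s' (fun b _ hb => by simp [hb]) (by simp)]
        simpa using h1) s
    rw [Pi.sub_apply, Pi.single_eq_same, Pi.single_eq_of_ne hne, sub_zero] at h2
    exact ht s' h2
  let e : Equiv.Perm (Fin R) := Equiv.ofBijective σ (Finite.injective_iff_bijective.1 hinj)
  have hfun : ∀ s, f (σ s) = t s • f' s := by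
    intro s
    ext X
    refine sub_eq_zero.1 ?_
    have h1 := Fintype.linearIndependent_iff.1 hxli
      (fun r => f r X - t (e.symm r) * f' (e.symm r) X) ?_ (σ s)
    · have h2 : e.symm (σ s) = s := e.symm_apply_apply s
      simpa [h2] using h1
    · ext i
      have h1 := DFunLike.congr_fun (hsum' i) X
      simp only [ContinuousMap.sum_apply, ContinuousMap.smul_apply, smul_eq_mul] at h1
      have h2 : ∑ r, x r i * (t (e.symm r) * f' (e.symm r) X) = ∑ s, x' s i * f' s X := by
        rw [← Equiv.sum_comp e]
        refine Finset.sum_congr rfl fun s _ => ?_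
        rw [e.symm_apply_apply, hσ s]
        change x (σ s) i * _ = (t s * x (σ s) i) * _
        ring
      simp only [Finset.sum_apply, Pi.smul_apply, smul_eq_mul, sub_mul, Finset.sum_sub_distrib,
        Pi.zero_apply]
      rw [sub_eq_zero]
      simpa only [mul_comm (x _ i)] using h1.trans h2.symm
  refine .of_prodTensor_eq (fun r => ?_) e fun s => ?_
  · obtain ⟨i, hi⟩ := Function.ne_iff.1 (hxli.ne_zero r)
    obtain ⟨X, hX⟩ := DFunLike.ne_iff.1 (hf.ne_zero r)
    refine Function.ne_iff.2 ⟨fun | none => X | some d => i d, ?_⟩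
    rw [prodTensor_modeFactors]
    exact mul_ne_zero hi hX
  · ext i
    have h1 : x' s (fun d => i (some d)) = t s * x (σ s) (fun d => i (some d)) := by
      rw [hσ s]; rfl
    have h2 : f (σ s) (i none) = t s * f' s (i none) := by rw [hfun s]; rfl
    rw [prodTensor_modeFactors, prodTensor_modeFactors]
    change x' s _ * f' s (i none) = x (σ s) _ * f (σ s) (i none)
    rw [h1, h2]
    ring

lemma linearIndependent_of_algebraicIndependent
    (hβ : AlgebraicIndependent ℚ fun t : Fin R × Σ d, Fin (p d) => β t.1 t.2.1 t.2.2)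
    (d : Fin D) (S : Finset (Fin R)) (hS : S.card ≤ p d) :
    LinearIndependent ℝ fun r : S => β r d := by
  classical
  obtain ⟨e⟩ := Function.Embedding.nonempty_of_card_le (α := S) (β := Fin (p d)) (by simpa using hS)
  have hβ' := hβ.comp (fun t : S × S => (t.1.1, ⟨d, e t.2⟩)) (by
    rintro ⟨r, s⟩ ⟨r', s'⟩ h
    simp only [Prod.mk.injEq, Sigma.mk.injEq, heq_eq_eq, true_and] at h
    rw [Subtype.ext h.1, e.injective h.2])
  have hM := Matrix.mvPolynomialX_mapMatrix_aeval ℚ (Matrix.of fun r s : S => β r d (e s))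
  have hdet : (Matrix.of fun r s : S => β r d (e s)).det ≠ 0 := by
    rw [← hM, ← AlgHom.map_det]
    exact fun h => Matrix.det_mvPolynomialX_ne_zero S ℚ (hβ' (by rw [map_zero]; exact h))
  have h1 := Matrix.linearIndependent_rows_iff_isUnit.2
    ((Matrix.isUnit_iff_isUnit_det _).2 (isUnit_iff_ne_zero.2 hdet))
  exact LinearIndependent.of_comp (LinearMap.funLeft ℝ ℝ e) h1

/-- Algebraically independent coefficients have the largest possible k-ranks. -/
theorem isUniqueRepresentation_of_sum_min (hp : ∀ d, 0 < p d)
    (hβ : AlgebraicIndependent ℚ fun t : Fin R × Σ d, Fin (p d) => β t.1 t.2.1 t.2.2)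
    (hR : R + D ≤ ∑ d, min (p d) R) {m : Covariate p → ℝ} {ν : ℝ}
    {f : Fin R → C(unitInterval, ℝ)} (hf : LinearIndependent ℝ f)
    (h : IsRepresentation m ν β f) : IsUniqueRepresentation m ν β f := by
  rcases R.eq_zero_or_pos with rfl | hR0
  · exact isUniqueRepresentation_zero h
  refine isUniqueRepresentation_of_kruskal hp h (fun r => ?_) (fun d => min (p d) R) R
    (fun d => le_min (hp d) hR0) hR0 (fun d => min_le_right _ _) le_rfl
    (fun d S hS => linearIndependent_of_algebraicIndependent hβ d S (by omega))
    (fun S _ => hf.comp _ Subtype.val_injective) (by omega)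
  obtain ⟨i, hi⟩ := Function.ne_iff.1 (prodTensor_ne_zero_of_algebraicIndependent hp hβ r)
  obtain ⟨X, hX⟩ := DFunLike.ne_iff.1 (hf.ne_zero r)
  refine Function.ne_iff.2 ⟨fun | none => X | some d => i d, ?_⟩
  rw [prodTensor_modeFactors]
  exact mul_ne_zero hi hX

theorem ae_isUniqueRepresentation [Nonempty (Fin D)] (hp : ∀ d, 0 < p d)
    (hR : R ≤ 1 ∨ R + (1 + ∑ d, (p d - 1)) ≤ ∏ d, p d ∨ R + D ≤ ∑ d, min (p d) R) :
    ∀ᵐ β : Coeffs p R ∂volume, ∀ (ν : ℝ) (f : Fin R → C(unitInterval, ℝ)),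
      (∀ r, f r ∈ meanZeroFunctions) → LinearIndependent ℝ f →
      IsUniqueRepresentation (broadcastedModel ν β f) ν β f := by
  filter_upwards [ae_algebraicIndependent_coeffs p R] with β hβ ν f hf0 hf
  have hrep : IsRepresentation (broadcastedModel ν β f) ν β f := ⟨hf0, fun _ => rfl⟩
  rcases hR with hR | hR | hR
  · exact isUniqueRepresentation_of_algebraicIndependent hp hβ (fun h => by omega) hf hrep
  · exact isUniqueRepresentation_of_algebraicIndependent hp hβ (fun _ => hR) hf hrep
  · exact isUniqueRepresentation_of_sum_min hp hβ hR hf hrep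

end Generic

/-- The bound for two modes is at most the codimension of the variety of rank-one matrices, except
for matrices with two rows or two columns, to which Kruskal's condition applies. -/
lemma two_mode_bound {R I J : ℕ} (hI : 0 < I) (hJ : 0 < J)
    (h : (R : ℝ) * (R - 1) ≤ (I : ℝ) * (I - 1) * J * (J - 1) / 2) :
    R ≤ 1 ∨ R + (1 + ((I - 1) + (J - 1))) ≤ I * J ∨ R + 2 ≤ min I R + min J R := by
  obtain ⟨I, rfl⟩ := Nat.exists_eq_add_of_le' hI
  obtain ⟨J, rfl⟩ := Nat.exists_eq_add_of_le' hJ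
  rcases R with _ | R
  · omega
  have h' : 2 * ((R + 1) * R) ≤ ((I + 1) * I) * ((J + 1) * J) := by
    push_cast at h
    have : (2 : ℝ) * ((R + 1) * R) ≤ ((I + 1) * I) * ((J + 1) * J) := by linarith
    exact_mod_cast this
  by_cases hc : R + 1 ≤ I * J
  · right; left
    simp only [Nat.add_sub_cancel]
    nlinarith
  push Not at hc
  rcases R.eq_zero_or_pos with rfl | hR
  · left; rfl
  have hIJ : 0 < I * J := by
    by_contra h0
    have h1 : I * J = 0 := by omega
    have h2 : ((I + 1) * I) * ((J + 1) * J) = (I * J) * ((I + 1) * (J + 1)) := by ring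
    rw [h2, h1, zero_mul] at h'
    have : 0 < (R + 1) * R := Nat.mul_pos (Nat.succ_pos R) hR
    omega
  have hI0 := Nat.pos_of_mul_pos_right hIJ
  have hJ0 := Nat.pos_of_mul_pos_left hIJ
  have hsmall : I = 1 ∨ J = 1 := by
    by_contra! hne
    obtain ⟨a, rfl⟩ := Nat.exists_eq_add_of_le' (show 2 ≤ I by omega)
    obtain ⟨b, rfl⟩ := Nat.exists_eq_add_of_le' (show 2 ≤ J by omega)
    have h1 : (a + 2) * (b + 2) ≤ R := by omega
    have h2 : ((a + 2) * (b + 2) + 1) * ((a + 2) * (b + 2)) ≤ (R + 1) * R := by gcongr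
    nlinarith [Nat.zero_le (a * b)]
  right; right
  rcases hsmall with rfl | rfl
  · have : R ≤ J := by
      by_contra! hlt
      nlinarith
    omega
  · have : R ≤ I := by
      by_contra! hlt
      nlinarith
    omega

lemma three_mode_bound_of_two_le {R I J K : ℕ} (hI : 2 ≤ I) (hJ : 2 ≤ J) (hK : 2 ≤ K)
    (h : (R : ℝ) * (R - 1) ≤ (I : ℝ) * J * K *
        (3 * I * J * K - I * J - I * K - J * K - I - J - K + 3) / 4) :
    R + (1 + ((I - 1) + (J - 1) + (K - 1))) ≤ I * J * K := by
  by_contra! hlt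
  obtain ⟨a, rfl⟩ := Nat.exists_eq_add_of_le' hI
  obtain ⟨b, rfl⟩ := Nat.exists_eq_add_of_le' hJ
  obtain ⟨c, rfl⟩ := Nat.exists_eq_add_of_le' hK
  have h1 : (a + 2) * (b + 2) * (c + 2) + 1 ≤ R + (1 + ((a + 1) + (b + 1) + (c + 1))) := by omega
  -- Here `R` is at least one more than the codimension `k` of the variety of rank-one tensors.
  set k : ℝ := ((a : ℝ) + 2) * (b + 2) * (c + 2) - (a + b + c + 4) with hk
  have ha : (0 : ℝ) ≤ a := a.cast_nonneg
  have hb : (0 : ℝ) ≤ b := b.cast_nonneg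
  have hc : (0 : ℝ) ≤ c := c.cast_nonneg
  have hk0 : 0 ≤ k := by
    have : k = a * b * c + 2 * (a * b) + 2 * (a * c) + 2 * (b * c) + 3 * a + 3 * b + 3 * c + 4 := by
      rw [hk]; ring
    rw [this]; positivity
  have h2 : k + 1 ≤ R := by
    have : ((a : ℝ) + 2) * (b + 2) * (c + 2) + 1 ≤ R + (1 + ((a + 1) + (b + 1) + (c + 1))) := by
      exact_mod_cast h1
    rw [hk]; linarith
  have h3 : (k + 1) * k ≤ R * (R - 1) := by
    refine mul_le_mul h2 (by linarith) hk0 (by linarith)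
  push_cast at h
  have h4 : 0 < 4 * ((k + 1) * k) - ((a : ℝ) + 2) * (b + 2) * (c + 2) *
      (3 * (a + 2) * (b + 2) * (c + 2) - (a + 2) * (b + 2) - (a + 2) * (c + 2) - (b + 2) * (c + 2)
        - (a + 2) - (b + 2) - (c + 2) + 3) := by
    rw [hk]
    ring_nf
    positivity
  linarith

/-- The bound for three modes; a mode of size one reduces it to the bound for two modes. -/
lemma three_mode_bound {R I J K : ℕ} (hI : 0 < I) (hJ : 0 < J) (hK : 0 < K)
    (h : (R : ℝ) * (R - 1) ≤ (I : ℝ) * J * K *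
        (3 * I * J * K - I * J - I * K - J * K - I - J - K + 3) / 4) :
    R ≤ 1 ∨ R + (1 + ((I - 1) + (J - 1) + (K - 1))) ≤ I * J * K ∨
      R + 3 ≤ min I R + min J R + min K R := by
  by_cases hI2 : I = 1
  · subst hI2
    rcases two_mode_bound hJ hK (R := R) (h.trans_eq (by push_cast; ring)) with h1 | h1 | h1
    · exact Or.inl h1
    · right; left; rw [one_mul]; omega
    · omega
  by_cases hJ2 : J = 1
  · subst hJ2
    rcases two_mode_bound hI hK (R := R) (h.trans_eq (by push_cast; ring)) with h1 | h1 | h1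
    · exact Or.inl h1
    · right; left; rw [mul_one]; omega
    · omega
  by_cases hK2 : K = 1
  · subst hK2
    rcases two_mode_bound hI hJ (R := R) (h.trans_eq (by push_cast; ring)) with h1 | h1 | h1
    · exact Or.inl h1
    · right; left; rw [mul_one]; omega
    · omega
  exact Or.inr (Or.inl (three_mode_bound_of_two_le (by omega) (by omega) (by omega) h))

theorem mainTheorem4 :
    -- general condition
    (∀ (D R : ℕ) (p : Fin D → ℕ) (m : Covariate p → ℝ)
      (ν : ℝ) (β : Coeffs p R) (f : Fin R → C(unitInterval, ℝ)),
      IsMinimalRepresentation m ν β f →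
      2 * R + D ≤ (∑ d, kRank (factorMatrix β d)) + 1 →
      IsUniqueRepresentation m ν β f) ∧
    -- linearly independent functions
    (∀ (D R : ℕ) (p : Fin D → ℕ) (m : Covariate p → ℝ)
      (ν : ℝ) (β : Coeffs p R) (f : Fin R → C(unitInterval, ℝ)),
      IsMinimalRepresentation m ν β f →
      LinearIndependent ℝ f →
      R + D ≤ ∑ d, kRank (factorMatrix β d) →
      IsUniqueRepresentation m ν β f) ∧
    -- linearly independent functions, generic coefficients, two modes
    (∀ (R : ℕ) (p : Fin 2 → ℕ), (∀ d, 0 < p d) →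
      (R : ℝ) * (R - 1) ≤ (p 0 : ℝ) * (p 0 - 1) * p 1 * (p 1 - 1) / 2 →
      ∀ᵐ β : Coeffs p R ∂volume, ∀ (ν : ℝ) (f : Fin R → C(unitInterval, ℝ)),
        (∀ r, f r ∈ meanZeroFunctions) → LinearIndependent ℝ f →
        IsUniqueRepresentation (broadcastedModel ν β f) ν β f) ∧
    -- linearly independent functions, generic coefficients, three modes
    (∀ (R : ℕ) (p : Fin 3 → ℕ), (∀ d, 0 < p d) →
      (R : ℝ) * (R - 1) ≤ (p 0 : ℝ) * p 1 * p 2 *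
        (3 * p 0 * p 1 * p 2 - p 0 * p 1 - p 0 * p 2 - p 1 * p 2 - p 0 - p 1 - p 2 + 3) / 4 →
      ∀ᵐ β : Coeffs p R ∂volume, ∀ (ν : ℝ) (f : Fin R → C(unitInterval, ℝ)),
        (∀ r, f r ∈ meanZeroFunctions) → LinearIndependent ℝ f →
        IsUniqueRepresentation (broadcastedModel ν β f) ν β f) := by

  refine ⟨fun D R p m ν β f h hk => h.isUnique_of_general hk,
    fun D R p m ν β f h hf hk => h.isUnique_of_linearIndependent hf hk,
    fun R p hp hR => ae_isUniqueRepresentation hp ?_,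
    fun R p hp hR => ae_isUniqueRepresentation hp ?_⟩
  · simpa only [Fin.sum_univ_two, Fin.prod_univ_two] using two_mode_bound (hp 0) (hp 1) hR
  · simpa only [Fin.sum_univ_three, Fin.prod_univ_three] using
      three_mode_bound (hp 0) (hp 1) (hp 2) hR
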